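/- Let $R$ be a commutative ring. Let $\mathrm{Rat}_R$ be the following category (composition is written in diagrammatic order). Its objects are the natural numbers. A map $n\to m$ is a pair $((f_1,\dots,f_m),\mathcal U)$, where $\mathcal U\subseteq R[x_1,\dots,x_n]$ is a restriction set, i.e. a multiplicatively closed set containing $1$ that is factor closed ($pq\in\mathcal U$ implies $p,q\in\mathcal U$) and is generated, as such a set, by finitely many polynomials, and each $f_i$ is a fraction $p_i/q_i$ in the localization $R[x_1,\dots,x_n][\mathcal U^{-1}]$. Write $\langle S\rangle$ for the factor closed multiplicative set generated by $S$. The identity of $n$ is $((x_1,\dots,x_n),\langle\rangle)$. The composite of $(f,\mathcal U):n\to m$ and $(g,\mathcal V):m\to k$ is obtained by substitution: its components are the $g_j(f_1,\dots,f_m)$, and its restriction set is generated by $\mathcal U$ and the numerators of the fractions $v(f_1,\dots,f_m)$, $v\in\mathcal V$. Equip $\mathrm{Rat}_R$ with the following operations. * Restriction: $\overline{(f,\mathcal U)}=((x_1,\dots,x_n),\mathcal U)$. * Products: terminal object $0$, with the map $((),\langle\rangle):n\to 0$; $n\times m=n+m$; projections $\pi_0=((x_1,\dots,x_n),\langle\rangle)$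 and $\pi_1=((x_{n+1},\dots,x_{n+m}),\langle\rangle)$; pairing $\langle(f,\mathcal U),(g,\mathcal V)\rangle=((f,g),\langle\mathcal U\cup\mathcal V\rangle)$. As usual, $f\times g=\langle\pi_0f,\pi_1g\rangle$ and $\Delta=\langle 1,1\rangle$. * Addition: $(f,\mathcal U)+(g,\mathcal V)=((f_i+g_i)_i,\langle\mathcal U\cup\mathcal V\rangle)$ and $0=((0,\dots,0),\langle\rangle)$. * Differentiation: for $(f,\mathcal U):n\to m$ the map $D[(f,\mathcal U)]:n\times n=2n\to m$ has as components the entries of $J_f(x_{n+1},\dots,x_{2n})\cdot(x_1,\dots,x_n)^{T}$, where $J_f=(\partial f_j/\partial x_i)$ is the formal Jacobian, $\frac{\partial}{\partial x_i}\frac pq=\frac{\frac{\partial p}{\partial x_i}q-p\frac{\partial q}{\partial x_i}}{q^2}$, and its restriction set is generated by the polynomials $u(x_{n+1},\dots,x_{2n})$, $u\in\mathcal U$. Then $\mathrm{Rat}_R$ is a differential restriction category, that is, the following hold. 1. It is a restriction category: $\overline f f=f$; $\overline g\,\overline f=\overline f\,\overline g$ and $\overline{\overline g f}=\overline g\,\overline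 f$ for $f,g$ with the same domain; $f\overline h=\overline{fh}f$ for composable $f,h$. Call $f$ total if $\overline f=1$, write $f\le g$ if $\overline f g=f$, and $f\smile g$ if $\overline f g=\overline g f$. 2. It is a cartesian restriction category: $!_A:A\to 0$ is the unique total map from $A$ to the terminal object, $!_0=1$, and $f\,!_B\le\, !_A$ for $f:A\to B$; the projections are total; $\langle f,g\rangle$ is the unique map $h$ with $h\pi_0=\overline h f$, $h\pi_1=\overline h g$ and $\overline h=\overline f\,\overline g$. 3. It is a left additive restriction category: every hom-set is a commutative monoid under $+$ and $0$, $\overline{f+g}=\overline f\,\overline g$, $\overline 0=1$, $f(g+h)=fg+fh$ and $f0=\overline f0$. 4. It is a cartesian left additive restriction category: $(f+g)\times(h+k)=(f\times h)+(g\times k)$, $0=0\times0$, and $\pi_0,\pi_1,\Delta$ are additive, where $f$ is additive if $(x+y)f\smile xf+yf$ and $0f\smile0$ for all $x,y$. 5. The differentiation satisfies * [DR.1] $D[f+g]=D[f]+D[g]$ and $D[0]=0$; * [DR.2] $\langle g+h,k\rangle D[f]=\langle g,k\rangle D[f]+\langle h,k\rangle D[f]$ and $\langle0,g\rangle D[f]=\overline{gf}\,0$;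 * [DR.3] $D[\pi_0]=\pi_0\pi_0$ and $D[\pi_1]=\pi_0\pi_1$; * [DR.4] $D[\langle f,g\rangle]=\langle D[f],D[g]\rangle$; * [DR.5] $D[fg]=\langle D[f],\pi_1f\rangle D[g]$; * [DR.6] $\langle\langle g,0\rangle,\langle h,k\rangle\rangle D[D[f]]=\overline h\,\langle g,k\rangle D[f]$; * [DR.7] $\langle\langle0,h\rangle,\langle g,k\rangle\rangle D[D[f]]=\langle\langle0,g\rangle,\langle h,k\rangle\rangle D[D[f]]$; * [DR.8] $D[\overline f]=(1\times\overline f)\pi_0$; * [DR.9] $\overline{D[f]}=1\times\overline f$. -/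

import Mathlib

open CategoryTheory

universe v w u

/-! ## Differential restriction categories

Composition is in diagrammatic order: `f ≫ g` is `f` followed by `g`. The operations are recorded
in data classes, the axioms about them in `Prop`-valued classes. -/

/-- The restriction operation `f ↦ rst f`. -/
class RestrictionOp (C : Type w) [Category.{v} C] where
  rst : ∀ {X Y : C}, (X ⟶ Y) → (X ⟶ X)

section AbstractNotions

open RestrictionOp

/-- Restriction categories. -/
class IsRestrictionCategory (C : Type w) [Category.{v} C] [RestrictionOp C] : Prop where
  rst_comp_self : ∀ {X Y : C} (f : X ⟶ Y), rst f ≫ f = f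
  rst_comm : ∀ {X Y Z : C} (f : X ⟶ Y) (g : X ⟶ Z), rst g ≫ rst f = rst f ≫ rst g
  rst_rst_comp : ∀ {X Y Z : C} (f : X ⟶ Y) (g : X ⟶ Z), rst (rst g ≫ f) = rst g ≫ rst f
  comp_rst : ∀ {X Y Z : C} (f : X ⟶ Y) (h : Y ⟶ Z), f ≫ rst h = rst (f ≫ h) ≫ f

section

variable {C : Type w} [Category.{v} C] [RestrictionOp C]

/-- A map is total if its restriction is the identity. -/
def IsTotalMap {X Y : C} (f : X ⟶ Y) : Prop := rst f = 𝟙 X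

/-- The restriction order on parallel maps. -/
def RestrictionLE {X Y : C} (f g : X ⟶ Y) : Prop := rst f ≫ g = f

/-- Compatibility of parallel maps: they agree where both are defined. -/
def Compatible {X Y : C} (f g : X ⟶ Y) : Prop := rst f ≫ g = rst g ≫ f

end

/-- The operations of a category with a chosen terminal object and chosen binary products. -/
class CartesianOps (C : Type w) [Category.{v} C] where
  one : C
  bang : ∀ X : C, X ⟶ one
  prod : C → C → C
  fst : ∀ X Y : C, prod X Y ⟶ X
  snd : ∀ X Y : C, prod X Y ⟶ Y
  pair : ∀ {X Y Z : C}, (Z ⟶ X) → (Z ⟶ Y) → (Z ⟶ prod X Y)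

open CartesianOps

/-- The product `f × g` of two maps. -/
def prodMap {C : Type w} [Category.{v} C] [CartesianOps C] {X Y X' Y' : C}
    (f : X ⟶ X') (g : Y ⟶ Y') : prod X Y ⟶ prod X' Y' :=
  pair (fst X Y ≫ f) (snd X Y ≫ g)

/-- Cartesian restriction categories: restriction categories with a restriction terminal object
and binary restriction products. The pairing of `f` and `g` is the unique map `h` with
`h π₀ ≤ f`, `h π₁ ≤ g` and `rst h = rst f ≫ rst g`. -/
class IsCartesianRestrictionCategory (C : Type w) [Category.{v} C] [RestrictionOp C]
    [CartesianOps C] : Prop extends IsRestrictionCategory C where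
  bang_total : ∀ X : C, IsTotalMap (bang X)
  bang_unique : ∀ {X : C} (f : X ⟶ (one : C)), IsTotalMap f → f = bang X
  bang_one : bang (one : C) = 𝟙 (one : C)
  comp_bang : ∀ {X Y : C} (f : X ⟶ Y), RestrictionLE (f ≫ bang Y) (bang X)
  fst_total : ∀ X Y : C, IsTotalMap (fst X Y)
  snd_total : ∀ X Y : C, IsTotalMap (snd X Y)
  pair_fst : ∀ {X Y Z : C} (f : Z ⟶ X) (g : Z ⟶ Y), pair f g ≫ fst X Y = rst (pair f g) ≫ f
  pair_snd : ∀ {X Y Z : C} (f : Z ⟶ X) (g : Z ⟶ Y), pair f g ≫ snd X Y = rst (pair f g) ≫ g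
  rst_pair : ∀ {X Y Z : C} (f : Z ⟶ X) (g : Z ⟶ Y), rst (pair f g) = rst f ≫ rst g
  pair_unique : ∀ {X Y Z : C} (f : Z ⟶ X) (g : Z ⟶ Y) (h : Z ⟶ prod X Y),
    h ≫ fst X Y = rst h ≫ f → h ≫ snd X Y = rst h ≫ g → rst h = rst f ≫ rst g → h = pair f g

/-- Left additive restriction categories. -/
class IsLeftAdditiveRestrictionCategory (C : Type w) [Category.{v} C] [RestrictionOp C]
    [∀ X Y : C, Add (X ⟶ Y)] [∀ X Y : C, Zero (X ⟶ Y)] : Prop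
    extends IsRestrictionCategory C where
  hom_add_assoc : ∀ {X Y : C} (f g h : X ⟶ Y), f + g + h = f + (g + h)
  hom_add_comm : ∀ {X Y : C} (f g : X ⟶ Y), f + g = g + f
  hom_zero_add : ∀ {X Y : C} (f : X ⟶ Y), 0 + f = f
  rst_add : ∀ {X Y : C} (f g : X ⟶ Y), rst (f + g) = rst f ≫ rst g
  rst_zero : ∀ X Y : C, rst (0 : X ⟶ Y) = 𝟙 X
  comp_add : ∀ {X Y Z : C} (f : X ⟶ Y) (g h : Y ⟶ Z), f ≫ (g + h) = f ≫ g + f ≫ h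
  comp_zero : ∀ {X Y : C} (Z : C) (f : X ⟶ Y), f ≫ (0 : Y ⟶ Z) = rst f ≫ (0 : X ⟶ Z)

/-- Additive maps of a left additive restriction category. -/
def IsAdditiveMap {C : Type w} [Category.{v} C] [RestrictionOp C]
    [∀ X Y : C, Add (X ⟶ Y)] [∀ X Y : C, Zero (X ⟶ Y)] {X Y : C} (f : X ⟶ Y) : Prop :=
  ∀ Z : C, (∀ x y : Z ⟶ X, Compatible ((x + y) ≫ f) (x ≫ f + y ≫ f)) ∧
    Compatible ((0 : Z ⟶ X) ≫ f) 0

/-- Cartesian left additive restriction categories. -/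
class IsCartesianLeftAdditiveRestrictionCategory (C : Type w) [Category.{v} C] [RestrictionOp C]
    [CartesianOps C] [∀ X Y : C, Add (X ⟶ Y)] [∀ X Y : C, Zero (X ⟶ Y)] : Prop
    extends IsCartesianRestrictionCategory C, IsLeftAdditiveRestrictionCategory C where
  prodMap_add : ∀ {X Y X' Y' : C} (f g : X ⟶ X') (h k : Y ⟶ Y'),
    prodMap (f + g) (h + k) = prodMap f h + prodMap g k
  prodMap_zero : ∀ X Y X' Y' : C,
    (0 : prod X Y ⟶ prod X' Y') = prodMap (0 : X ⟶ X') (0 : Y ⟶ Y')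
  fst_additive : ∀ X Y : C, IsAdditiveMap (fst X Y)
  snd_additive : ∀ X Y : C, IsAdditiveMap (snd X Y)
  diag_additive : ∀ X : C, IsAdditiveMap (pair (𝟙 X) (𝟙 X))

/-- The differentiation operation. -/
class DifferentialOp (C : Type w) [Category.{v} C] [CartesianOps C] where
  D : ∀ {X Y : C}, (X ⟶ Y) → (prod X X ⟶ Y)

open DifferentialOp

/-- Differential restriction categories: cartesian left additive restriction categories with a
differentiation operation satisfying the axioms below. -/
class IsDifferentialRestrictionCategory (C : Type w) [Category.{v} C] [RestrictionOp C]
    [CartesianOps C] [∀ X Y : C, Add (X ⟶ Y)] [∀ X Y : C, Zero (X ⟶ Y)] [DifferentialOp C] : Prop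
    extends IsCartesianLeftAdditiveRestrictionCategory C where
  dr1_add : ∀ {X Y : C} (f g : X ⟶ Y), D (f + g) = D f + D g
  dr1_zero : ∀ X Y : C, D (0 : X ⟶ Y) = 0
  dr2_add : ∀ {X Y Z : C} (f : X ⟶ Y) (g h k : Z ⟶ X),
    pair (g + h) k ≫ D f = pair g k ≫ D f + pair h k ≫ D f
  dr2_zero : ∀ {X Y Z : C} (f : X ⟶ Y) (g : Z ⟶ X),
    pair 0 g ≫ D f = rst (g ≫ f) ≫ (0 : Z ⟶ Y)
  dr3_fst : ∀ X Y : C, D (fst X Y) = fst (prod X Y) (prod X Y) ≫ fst X Y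
  dr3_snd : ∀ X Y : C, D (snd X Y) = fst (prod X Y) (prod X Y) ≫ snd X Y
  dr4 : ∀ {X Y Z : C} (f : Z ⟶ X) (g : Z ⟶ Y), D (pair f g) = pair (D f) (D g)
  dr5 : ∀ {X Y Z : C} (f : X ⟶ Y) (g : Y ⟶ Z), D (f ≫ g) = pair (D f) (snd X X ≫ f) ≫ D g
  dr6 : ∀ {X Y Z : C} (f : X ⟶ Y) (g h k : Z ⟶ X),
    pair (pair g 0) (pair h k) ≫ D (D f) = rst h ≫ pair g k ≫ D f
  dr7 : ∀ {X Y Z : C} (f : X ⟶ Y) (g h k : Z ⟶ X),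
    pair (pair 0 h) (pair g k) ≫ D (D f) = pair (pair 0 g) (pair h k) ≫ D (D f)
  dr8 : ∀ {X Y : C} (f : X ⟶ Y), D (rst f) = prodMap (𝟙 X) (rst f) ≫ fst X X
  dr9 : ∀ {X Y : C} (f : X ⟶ Y), rst (D f) = prodMap (𝟙 X) (rst f)

end AbstractNotions

/-! ## Restriction sets and fractions -/

section Sets

variable {A : Type u} [CommRing A]

/-- The factor closed multiplicative set generated by `S`. -/
def genBy (S : Set A) : SaturatedSubmonoid A := (Submonoid.closure S).saturation

/-- `U` is finitely generated as a factor closed multiplicative set. -/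
def FinGen (U : SaturatedSubmonoid A) : Prop := ∃ S : Finset A, genBy (S : Set A) = U

theorem genBy_le {S : Set A} {U : SaturatedSubmonoid A} : genBy S ≤ U ↔ ∀ a ∈ S, a ∈ U := by
  rw [genBy, Submonoid.saturation_le_iff_le, Submonoid.closure_le]; rfl

theorem subset_genBy {S : Set A} {a : A} (h : a ∈ S) : a ∈ genBy S :=
  genBy_le.1 le_rfl a h

theorem genBy_union (S T : Set A) : genBy (S ∪ T) = genBy S ⊔ genBy T := by
  rw [genBy, genBy, genBy, Submonoid.closure_union, Submonoid.saturation_sup]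

theorem finGen_bot : FinGen (⊥ : SaturatedSubmonoid A) :=
  ⟨∅, by simp [genBy]⟩

theorem FinGen.sup {U V : SaturatedSubmonoid A} (hU : FinGen U) (hV : FinGen V) :
    FinGen (U ⊔ V) := by
  classical
  obtain ⟨S, rfl⟩ := hU
  obtain ⟨T, rfl⟩ := hV
  exact ⟨S ∪ T, by rw [Finset.coe_union, genBy_union]⟩

/-- The fractions with denominators in `U`, all elements of `U` being cancellable. -/
abbrev Frac (U : SaturatedSubmonoid A) : Type u := Localization U.toSubmonoid

theorem isUnit_frac {U : SaturatedSubmonoid A} {a : A} :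
    IsUnit (algebraMap A (Frac U) a) ↔ a ∈ U := by
  refine ⟨fun h => ?_, fun h => IsLocalization.map_units (Frac U) (⟨a, h⟩ : U.toSubmonoid)⟩
  obtain ⟨b, hb, c, rfl⟩ := (IsLocalization.algebraMap_isUnit_iff U.toSubmonoid).1 h
  exact (U.mulSaturated hb).1

variable {B : Type*} [CommRing B]

/-- The elements which a homomorphism makes invertible. -/
def unitSet {F : Type*} [FunLike F A B] [MonoidHomClass F A B] (φ : F) :
    SaturatedSubmonoid A where
  toSubmonoid := (IsUnit.submonoid B).comap φ
  mulSaturated := .of_left fun x y h => by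
    have : IsUnit (φ (x * y)) := h
    rw [map_mul] at this
    exact isUnit_of_mul_isUnit_left this

theorem isUnit_of_mem_genBy {F : Type*} [FunLike F A B] [MonoidHomClass F A B] {S : Set A} (φ : F)
    (h : ∀ s ∈ S, IsUnit (φ s)) : ∀ a ∈ genBy S, IsUnit (φ a) := fun _ ha =>
  (genBy_le (U := unitSet φ)).2 h ha

end Sets

/-! ## The category of rational polynomials -/

/-- The objects of the category of rational polynomials over `R`: the natural numbers. -/
structure RatCat (R : Type u) : Type where
  dim : ℕ

noncomputable section

open MvPolynomial

variable {R : Type u} [CommRing R] {n m k : ℕ}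

/-- Extension to fractions of a substitution which makes all denominators invertible. -/
def fracLift {V : SaturatedSubmonoid (MvPolynomial (Fin m) R)} {B : Type u} [CommRing B]
    [Algebra R B] (φ : MvPolynomial (Fin m) R →ₐ[R] B) (h : ∀ v ∈ V, IsUnit (φ v)) :
    Frac V →ₐ[R] B :=
  IsLocalization.liftAlgHom (M := V.toSubmonoid) (f := φ) fun y => h y y.2

@[simp]
theorem fracLift_algebraMap {V : SaturatedSubmonoid (MvPolynomial (Fin m) R)} {B : Type u}
    [CommRing B] [Algebra R B] (φ : MvPolynomial (Fin m) R →ₐ[R] B) (h : ∀ v ∈ V, IsUnit (φ v))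
    (p : MvPolynomial (Fin m) R) : fracLift φ h (algebraMap _ (Frac V) p) = φ p :=
  IsLocalization.lift_eq _ p

/-- A polynomial as a fraction with denominator `1`. -/
def fracOf (U : SaturatedSubmonoid (MvPolynomial (Fin n) R)) :
    MvPolynomial (Fin n) R →ₐ[R] Frac U :=
  IsScalarTower.toAlgHom R (MvPolynomial (Fin n) R) (Frac U)

theorem fracOf_apply (U : SaturatedSubmonoid (MvPolynomial (Fin n) R))
    (p : MvPolynomial (Fin n) R) : fracOf U p = algebraMap _ (Frac U) p := rfl

@[simp]
theorem fracLift_fracOf {V : SaturatedSubmonoid (MvPolynomial (Fin m) R)} {B : Type u}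
    [CommRing B] [Algebra R B] (φ : MvPolynomial (Fin m) R →ₐ[R] B) (h : ∀ v ∈ V, IsUnit (φ v))
    (p : MvPolynomial (Fin m) R) : fracLift φ h (fracOf V p) = φ p :=
  fracLift_algebraMap φ h p

theorem fracAlgHom_ext {V : SaturatedSubmonoid (MvPolynomial (Fin m) R)} {B : Type u}
    [CommRing B] [Algebra R B] (φ ψ : Frac V →ₐ[R] B)
    (h : ∀ i : Fin m, φ (fracOf V (X i)) = ψ (fracOf V (X i))) (z : Frac V) : φ z = ψ z := by
  have : φ = ψ := IsLocalization.algHom_ext V.toSubmonoid (MvPolynomial.algHom_ext h)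
  rw [this]

/-- Enlarging the set of denominators. -/
def fracMap {U V : SaturatedSubmonoid (MvPolynomial (Fin n) R)} (h : U ≤ V) :
    Frac U →ₐ[R] Frac V :=
  fracLift (fracOf V) fun _ hu => isUnit_frac.2 (h hu)

@[simp]
theorem fracMap_fracOf {U V : SaturatedSubmonoid (MvPolynomial (Fin n) R)} (h : U ≤ V)
    (p : MvPolynomial (Fin n) R) : fracMap h (fracOf U p) = fracOf V p :=
  fracLift_fracOf _ _ p

theorem mk_mul_fracOf {U : SaturatedSubmonoid (MvPolynomial (Fin n) R)}
    (a : MvPolynomial (Fin n) R) (u : U.toSubmonoid) :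
    (Localization.mk a u : Frac U) * fracOf U u = fracOf U a := by
  rw [Localization.mk_eq_mk', fracOf_apply, fracOf_apply]
  exact IsLocalization.mk'_spec _ a u

/-- A homomorphism out of a ring of fractions sends a fraction to a unit exactly if it does so
with its numerator. -/
theorem isUnit_map_mk {U : SaturatedSubmonoid (MvPolynomial (Fin n) R)} {B : Type u} [CommRing B]
    [Algebra R B] (χ : Frac U →ₐ[R] B) (a : MvPolynomial (Fin n) R) (u : U.toSubmonoid) :
    IsUnit (χ (Localization.mk a u)) ↔ IsUnit (χ (fracOf U a)) := by
  have hu : IsUnit (χ (fracOf U u)) := (isUnit_frac.2 u.2).map χ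
  rw [← mk_mul_fracOf a u, map_mul]
  exact (hu.mul_right_iff).symm

theorem exists_mk {U : SaturatedSubmonoid (MvPolynomial (Fin n) R)} (z : Frac U) :
    ∃ (a : MvPolynomial (Fin n) R) (u : U.toSubmonoid), Localization.mk a u = z := by
  obtain ⟨a, u, h⟩ := IsLocalization.exists_mk'_eq U.toSubmonoid z
  exact ⟨a, u, by rw [Localization.mk_eq_mk']; exact h⟩

theorem le_iff_isUnit {U T : SaturatedSubmonoid (MvPolynomial (Fin n) R)} :
    U ≤ T ↔ ∀ u ∈ U, IsUnit (fracOf T u) :=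
  forall₂_congr fun _ _ => isUnit_frac.symm

@[simp]
theorem fracLift_fracMap {U V : SaturatedSubmonoid (MvPolynomial (Fin n) R)} (h : U ≤ V)
    {B : Type u} [CommRing B] [Algebra R B] (χ : MvPolynomial (Fin n) R →ₐ[R] B)
    (hχ : ∀ v ∈ V, IsUnit (χ v)) (z : Frac U) :
    fracLift χ hχ (fracMap h z) = fracLift χ (fun u hu => hχ u (h hu)) z :=
  fracAlgHom_ext ((fracLift χ hχ).comp (fracMap h)) _ (fun i => by simp) z

theorem fracMap_fracMap {U V W : SaturatedSubmonoid (MvPolynomial (Fin n) R)} (h : U ≤ V)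
    (h2 : V ≤ W) (z : Frac U) : fracMap h2 (fracMap h z) = fracMap (h.trans h2) z :=
  fracLift_fracMap h _ _ z

theorem fracMap_refl {U : SaturatedSubmonoid (MvPolynomial (Fin n) R)} (h : U ≤ U)
    (z : Frac U) : fracMap h z = z :=
  fracAlgHom_ext (fracMap h) (AlgHom.id R (Frac U)) (fun i => by simp) z

namespace RatCat

/-- A map `n ⟶ m`: an `m`-tuple of rational polynomials in `n` variables together with a finitely
generated factor closed multiplicative set of polynomials, the restriction set, containing all
denominators. -/
@[ext]
structure Hom (R : Type u) [CommRing R] (n m : ℕ) : Type u where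
  rset : SaturatedSubmonoid (MvPolynomial (Fin n) R)
  finGen : FinGen rset
  fn : Fin m → Frac rset

namespace Hom

theorem fn_ext {U : SaturatedSubmonoid (MvPolynomial (Fin n) R)} {φ ψ : Fin m → Frac U}
    (h : U ≤ U) (h2 : ∀ i, fracMap h (φ i) = ψ i) : φ = ψ := by
  funext i
  rw [← h2 i, fracMap_refl]

theorem ext_of_eq {f g : Hom R n m} (h : f.rset = g.rset)
    (h2 : ∀ i, fracMap h.le (f.fn i) = g.fn i) : f = g := by
  obtain ⟨U, hU, φ⟩ := f
  obtain ⟨V, hV, ψ⟩ := g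
  obtain rfl : U = V := h
  have h3 : φ = ψ := fn_ext _ h2
  rw [h3]

/-- The map given by polynomials and the restriction set generated by the empty set. -/
def ofPoly (p : Fin m → MvPolynomial (Fin n) R) : Hom R n m where
  rset := ⊥
  finGen := finGen_bot
  fn i := fracOf ⊥ (p i)

/-- Substitution of the components of `f` for the variables of a polynomial. -/
def subst (f : Hom R n m) : MvPolynomial (Fin m) R →ₐ[R] Frac f.rset := aeval f.fn

@[simp]
theorem subst_X (f : Hom R n m) (i : Fin m) : f.subst (X i) = f.fn i := aeval_X _ i

/-- All the numerators of the fractions obtained by substituting the components of `f` for the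
variables of the polynomials in `V`. -/
def numerators (f : Hom R n m) (V : Set (MvPolynomial (Fin m) R)) :
    Set (MvPolynomial (Fin n) R) :=
  {a | ∃ v ∈ V, ∃ u : f.rset.toSubmonoid, Localization.mk a u = f.subst v}

/-- The restriction set of a composite: it is generated by the restriction set of `f` and the
polynomials which arise by substitution into those of `V`. -/
def compSet (f : Hom R n m) (V : SaturatedSubmonoid (MvPolynomial (Fin m) R)) :
    SaturatedSubmonoid (MvPolynomial (Fin n) R) :=
  f.rset ⊔ genBy (f.numerators V)

theorem le_compSet (f : Hom R n m) (V : SaturatedSubmonoid (MvPolynomial (Fin m) R)) :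
    f.rset ≤ f.compSet V := le_sup_left

theorem compSet_isUnit_iff (f : Hom R n m) {V : SaturatedSubmonoid (MvPolynomial (Fin m) R)}
    {B : Type u} [CommRing B] [Algebra R B] (χ : MvPolynomial (Fin n) R →ₐ[R] B)
    (h : ∀ u ∈ f.rset, IsUnit (χ u)) :
    (∀ u ∈ f.compSet V, IsUnit (χ u)) ↔ ∀ v ∈ V, IsUnit (fracLift χ h (f.subst v)) := by
  constructor
  · intro H v hv
    obtain ⟨a, u, hau⟩ := exists_mk (f.subst v)
    rw [← hau, isUnit_map_mk, fracLift_fracOf]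
    exact H a ((le_sup_right : genBy (f.numerators V) ≤ _) (subset_genBy ⟨v, hv, u, hau⟩))
  · intro H
    have h1 : f.rset ⊔ genBy (f.numerators V) ≤ unitSet χ := by
      refine sup_le h (genBy_le.2 ?_)
      rintro a ⟨v, hv, u, hau⟩
      have := H v hv
      rw [← hau, isUnit_map_mk, fracLift_fracOf] at this
      exact this
    exact fun u hu => h1 hu

theorem isUnit_subst (f : Hom R n m) (V : SaturatedSubmonoid (MvPolynomial (Fin m) R)) :
    ∀ v ∈ V, IsUnit (((fracMap (f.le_compSet V)).comp f.subst) v) :=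
  (f.compSet_isUnit_iff (fracOf (f.compSet V)) (le_iff_isUnit.1 (f.le_compSet V))).1
    (le_iff_isUnit.1 le_rfl)

theorem finGen_compSet (f : Hom R n m) {V : SaturatedSubmonoid (MvPolynomial (Fin m) R)}
    (hV : FinGen V) : FinGen (f.compSet V) := by
  classical
  obtain ⟨S, rfl⟩ := hV
  choose a u hau using fun v => exists_mk (f.subst v)
  obtain ⟨T, hT⟩ : ∃ T, T = genBy ((S.image a : Finset _) : Set (MvPolynomial (Fin n) R)) :=
    ⟨_, rfl⟩
  have haT : ∀ v ∈ S, a v ∈ T := fun v hv => by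
    rw [hT]; exact subset_genBy (Finset.mem_coe.2 (Finset.mem_image_of_mem a hv))
  suffices h : f.compSet (genBy S) = f.rset ⊔ T by
    rw [h]; exact f.finGen.sup ⟨_, hT.symm⟩
  apply le_antisymm
  · have h0 : ∀ u ∈ f.rset, IsUnit (fracOf (f.rset ⊔ T) u) := le_iff_isUnit.1 le_sup_left
    have h1 : ∀ v ∈ T, IsUnit (fracOf (f.rset ⊔ T) v) := le_iff_isUnit.1 le_sup_right
    rw [le_iff_isUnit, f.compSet_isUnit_iff _ h0]
    refine isUnit_of_mem_genBy ((fracLift _ h0).comp f.subst) fun v hv => ?_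
    rw [AlgHom.comp_apply, ← hau, isUnit_map_mk, fracLift_fracOf]
    exact h1 _ (haT v hv)
  · rw [hT]
    refine sup_le_sup_left (genBy_le.2 fun b hb => ?_) _
    obtain ⟨v, hv, rfl⟩ := Finset.mem_image.1 (Finset.mem_coe.1 hb)
    exact subset_genBy ⟨v, subset_genBy hv, u v, hau v⟩

/-- Substitution of the components of `f` for the variables of a fraction with denominator
in `V`. -/
def fracSubst (f : Hom R n m) (V : SaturatedSubmonoid (MvPolynomial (Fin m) R)) :
    Frac V →ₐ[R] Frac (f.compSet V) :=
  fracLift ((fracMap (f.le_compSet V)).comp f.subst) (f.isUnit_subst V)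

/-- Composition by substitution, `f` followed by `g`. -/
def comp (f : Hom R n m) (g : Hom R m k) : Hom R n k where
  rset := f.compSet g.rset
  finGen := f.finGen_compSet g.finGen
  fn j := f.fracSubst g.rset (g.fn j)

/-- The restriction of `f`: the identity tuple with the restriction set of `f`. -/
def restrict (f : Hom R n m) : Hom R n n where
  rset := f.rset
  finGen := f.finGen
  fn i := fracOf f.rset (X i)

/-- The pairing of two maps. -/
def pair (f : Hom R k n) (g : Hom R k m) : Hom R k (n + m) where
  rset := f.rset ⊔ g.rset
  finGen := f.finGen.sup g.finGen
  fn := Fin.append (fun i => fracMap le_sup_left (f.fn i)) (fun i => fracMap le_sup_right (g.fn i))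

/-- The sum of two maps. -/
def add (f g : Hom R n m) : Hom R n m where
  rset := f.rset ⊔ g.rset
  finGen := f.finGen.sup g.finGen
  fn i := fracMap le_sup_left (f.fn i) + fracMap le_sup_right (g.fn i)

end Hom

/-- The formal partial derivative of a fraction, given by the quotient rule. -/
def fracPderiv {U : SaturatedSubmonoid (MvPolynomial (Fin n) R)} (i : Fin n) (z : Frac U) :
    Frac U :=
  Localization.liftOn z
    (fun p q => Localization.mk (pderiv i p * q - p * pderiv i (q : MvPolynomial (Fin n) R))
      (q ^ 2))
    (by
      intro p p' q q' h
      obtain ⟨c, hc⟩ := Localization.r_iff_exists.1 h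
      rw [Localization.mk_eq_mk_iff, Localization.r_iff_exists]
      have hd := congrArg (pderiv i) hc
      simp only [Derivation.leibniz, smul_eq_mul] at hd
      refine ⟨c ^ 2, ?_⟩
      simp only [SubmonoidClass.coe_pow]
      linear_combination (q * q' * c : MvPolynomial (Fin n) R) * hd -
        (q * q' * pderiv i (c : MvPolynomial (Fin n) R)) * hc -
        c * (q' * pderiv i (q : MvPolynomial (Fin n) R) +
          q * pderiv i (q' : MvPolynomial (Fin n) R)) * hc)

/-- The shift of variables `x i ↦ x (n + i)`. -/
def shiftVars (R : Type u) [CommRing R] (n : ℕ) :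
    MvPolynomial (Fin n) R →ₐ[R] MvPolynomial (Fin (n + n)) R :=
  rename (Fin.natAdd n)

/-- The set generated by the shifts of the polynomials in `U`. -/
def shiftSet (U : SaturatedSubmonoid (MvPolynomial (Fin n) R)) :
    SaturatedSubmonoid (MvPolynomial (Fin (n + n)) R) :=
  genBy (shiftVars R n '' U)

theorem finGen_shiftSet {U : SaturatedSubmonoid (MvPolynomial (Fin n) R)} (hU : FinGen U) :
    FinGen (shiftSet U) := by
  classical
  obtain ⟨S, rfl⟩ := hU
  refine ⟨S.image (shiftVars R n), le_antisymm (genBy_le.2 ?_) (genBy_le.2 ?_)⟩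
  · rintro _ hb
    obtain ⟨v, hv, rfl⟩ := Finset.mem_image.1 (Finset.mem_coe.1 hb)
    exact subset_genBy ⟨v, subset_genBy hv, rfl⟩
  · rintro _ ⟨v, hv, rfl⟩
    have h := isUnit_of_mem_genBy (S := (S : Set (MvPolynomial (Fin n) R)))
      ((fracOf (genBy (S.image (shiftVars R n) : Set _))).comp (shiftVars R n))
      fun a ha => isUnit_frac.2 (subset_genBy
        (Finset.mem_coe.2 (Finset.mem_image_of_mem (shiftVars R n) ha)))
    exact isUnit_frac.1 (h v hv)

/-- The shift of variables on fractions. -/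
def fracShift (U : SaturatedSubmonoid (MvPolynomial (Fin n) R)) :
    Frac U →ₐ[R] Frac (shiftSet U) :=
  fracLift ((fracOf (shiftSet U)).comp (shiftVars R n)) fun u hu =>
    isUnit_frac.2 (subset_genBy ⟨u, hu, rfl⟩)

/-- The differential of `f`: the formal Jacobian matrix of `f` at the point given by the last `n`
variables, applied to the vector of the first `n` variables. -/
def Hom.diff (f : Hom R n m) : Hom R (n + n) m where
  rset := shiftSet f.rset
  finGen := finGen_shiftSet f.finGen
  fn j := ∑ i : Fin n,
    fracShift f.rset (fracPderiv i (f.fn j)) * fracOf (shiftSet f.rset) (X (Fin.castAdd n i))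

namespace Hom

@[simp]
theorem fracSubst_fracOf (f : Hom R n m) (V : SaturatedSubmonoid (MvPolynomial (Fin m) R))
    (p : MvPolynomial (Fin m) R) :
    f.fracSubst V (fracOf V p) = fracMap (f.le_compSet V) (f.subst p) :=
  fracLift_fracOf _ _ p

theorem subst_ofPoly_X (p : MvPolynomial (Fin n) R) :
    (ofPoly X : Hom R n n).subst p = fracOf ⊥ p := by
  have : (ofPoly X : Hom R n n).subst = fracOf ⊥ :=
    MvPolynomial.algHom_ext fun i => subst_X (ofPoly X) i
  rw [this]
  rfl

theorem ofPoly_X_comp (f : Hom R n m) : (ofPoly X : Hom R n n).comp f = f := by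
  have hr : (ofPoly X : Hom R n n).compSet f.rset = f.rset := by
    refine eq_of_forall_ge_iff fun T => ?_
    have h0 : ∀ u ∈ (ofPoly X : Hom R n n).rset, IsUnit (fracOf T u) :=
      le_iff_isUnit.1 (bot_le : ⊥ ≤ T)
    rw [le_iff_isUnit, compSet_isUnit_iff _ _ h0, le_iff_isUnit]
    refine forall₂_congr fun v _ => ?_
    rw [subst_ofPoly_X]
    exact iff_of_eq (congrArg IsUnit (fracLift_fracOf (fracOf T) h0 v))
  refine ext_of_eq hr fun j => ?_
  refine fracAlgHom_ext ((fracMap hr.le).comp ((ofPoly X : Hom R n n).fracSubst f.rset))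
    (AlgHom.id R (Frac f.rset)) (fun i => ?_) (f.fn j)
  rw [AlgHom.comp_apply, fracSubst_fracOf, subst_ofPoly_X]
  exact (congrArg _ (fracMap_fracOf _ _)).trans (fracMap_fracOf _ _)

theorem comp_ofPoly_X (f : Hom R n m) : f.comp (ofPoly X) = f := by
  have hr : f.compSet ⊥ = f.rset := by
    refine eq_of_forall_ge_iff fun T => ⟨(f.le_compSet ⊥).trans, fun h => ?_⟩
    rw [le_iff_isUnit] at h ⊢
    rw [compSet_isUnit_iff _ _ h]
    intro v hv
    exact ((SaturatedSubmonoid.mem_bot_iff.1 hv).map f.subst).map _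
  refine ext_of_eq hr fun j => ?_
  have h1 : f.fracSubst ⊥ (fracOf ⊥ (X j)) = fracMap (f.le_compSet ⊥) (f.fn j) := by
    rw [fracSubst_fracOf, subst_X]
  exact (congrArg (fracMap hr.le) h1).trans ((fracMap_fracMap _ _ _).trans (fracMap_refl _ _))

theorem fracLift_fracSubst (f : Hom R n m) (V : SaturatedSubmonoid (MvPolynomial (Fin m) R))
    {B : Type u} [CommRing B] [Algebra R B] (χ : MvPolynomial (Fin n) R →ₐ[R] B)
    (h : ∀ u ∈ f.compSet V, IsUnit (χ u)) (h1 : ∀ u ∈ f.rset, IsUnit (χ u))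
    (h2 : ∀ v ∈ V, IsUnit (((fracLift χ h1).comp f.subst) v)) (z : Frac V) :
    fracLift χ h (f.fracSubst V z) = fracLift ((fracLift χ h1).comp f.subst) h2 z :=
  fracAlgHom_ext ((fracLift χ h).comp (f.fracSubst V)) _ (fun i => by simp) z

theorem compSet_assoc (f : Hom R n m) (g : Hom R m k)
    (W : SaturatedSubmonoid (MvPolynomial (Fin k) R)) :
    (f.comp g).compSet W = f.compSet (g.compSet W) := by
  refine eq_of_forall_ge_iff fun T => ?_
  have key : ∀ (h1 : ∀ u ∈ f.rset, IsUnit (fracOf T u))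
      (h : ∀ u ∈ (f.comp g).rset, IsUnit (fracOf T u))
      (h2 : ∀ v ∈ g.rset, IsUnit (((fracLift (fracOf T) h1).comp f.subst) v)),
      (fracLift (fracOf T) h).comp (f.comp g).subst =
        (fracLift ((fracLift (fracOf T) h1).comp f.subst) h2).comp g.subst := by
    intro h1 h h2
    refine MvPolynomial.algHom_ext fun i => ?_
    simp only [AlgHom.comp_apply, subst_X]
    exact f.fracLift_fracSubst g.rset (fracOf T) h h1 h2 (g.fn i)
  rw [le_iff_isUnit, le_iff_isUnit]
  constructor
  · intro H
    have h : ∀ u ∈ (f.comp g).rset, IsUnit (fracOf T u) := fun u hu =>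
      H u ((f.comp g).le_compSet W hu)
    have h1 : ∀ u ∈ f.rset, IsUnit (fracOf T u) := fun u hu => h u (f.le_compSet g.rset hu)
    have h2 := (f.compSet_isUnit_iff (fracOf T) h1).1 h
    rw [compSet_isUnit_iff _ _ h] at H
    rw [compSet_isUnit_iff _ _ h1]
    refine (g.compSet_isUnit_iff ((fracLift (fracOf T) h1).comp f.subst) h2).2 fun w hw => ?_
    have := H w hw
    rw [← AlgHom.comp_apply, key h1 h h2] at this
    exact this
  · intro H
    have h1 : ∀ u ∈ f.rset, IsUnit (fracOf T u) := fun u hu => H u (f.le_compSet _ hu)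
    rw [compSet_isUnit_iff _ _ h1] at H
    have h2 : ∀ v ∈ g.rset, IsUnit (((fracLift (fracOf T) h1).comp f.subst) v) := fun v hv =>
      H v (g.le_compSet W hv)
    have h : ∀ u ∈ (f.comp g).rset, IsUnit (fracOf T u) :=
      (f.compSet_isUnit_iff (fracOf T) h1).2 h2
    rw [compSet_isUnit_iff _ _ h]
    intro w hw
    have := (g.compSet_isUnit_iff ((fracLift (fracOf T) h1).comp f.subst) h2).1 H w hw
    rw [← AlgHom.comp_apply, key h1 h h2]
    exact this

theorem comp_assoc {l : ℕ} (f : Hom R n m) (g : Hom R m k) (h : Hom R k l) :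
    (f.comp g).comp h = f.comp (g.comp h) := by
  have hr := f.compSet_assoc g h.rset
  refine ext_of_eq hr fun j => ?_
  refine fracAlgHom_ext ((fracMap hr.le).comp ((f.comp g).fracSubst h.rset))
    ((f.fracSubst (g.compSet h.rset)).comp (g.fracSubst h.rset)) (fun i => ?_) (h.fn j)
  simp only [AlgHom.comp_apply, fracSubst_fracOf, fracMap_fracMap, subst_X]
  have hle : f.compSet g.rset ≤ f.compSet (g.compSet h.rset) :=
    ((f.comp g).le_compSet h.rset).trans hr.le
  refine fracAlgHom_ext ((fracMap hle).comp (f.fracSubst g.rset))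
    ((f.fracSubst (g.compSet h.rset)).comp (fracMap (g.le_compSet h.rset))) (fun i => ?_) (g.fn i)
  simp only [AlgHom.comp_apply, fracSubst_fracOf, fracMap_fracMap, subst_X, fracMap_fracOf]

end Hom

instance : Category.{u} (RatCat R) where
  Hom A B := Hom R A.dim B.dim
  id A := (Hom.ofPoly X : Hom R A.dim A.dim)
  comp f g := Hom.comp f g
  id_comp f := Hom.ofPoly_X_comp f
  comp_id f := Hom.comp_ofPoly_X f
  assoc f g h := Hom.comp_assoc f g h

instance : RestrictionOp (RatCat R) where
  rst f := Hom.restrict f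

instance : CartesianOps (RatCat R) where
  one := ⟨0⟩
  bang A := (Hom.ofPoly Fin.elim0 : Hom R A.dim 0)
  prod A B := ⟨A.dim + B.dim⟩
  fst A B := (Hom.ofPoly fun i => X (Fin.castAdd B.dim i) : Hom R (A.dim + B.dim) A.dim)
  snd A B := (Hom.ofPoly fun i => X (Fin.natAdd A.dim i) : Hom R (A.dim + B.dim) B.dim)
  pair f g := Hom.pair f g

instance (A B : RatCat R) : Add (A ⟶ B) where
  add f g := Hom.add f g

instance (A B : RatCat R) : Zero (A ⟶ B) where
  zero := (Hom.ofPoly 0 : Hom R A.dim B.dim)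

instance : DifferentialOp (RatCat R) where
  D f := Hom.diff f

end RatCat

end

noncomputable section

open MvPolynomial RestrictionOp CartesianOps DifferentialOp

namespace RatCat

section

variable {R : Type u} [CommRing R] {n m k : ℕ}
variable {B C : Type u} [CommRing B] [Algebra R B] [CommRing C] [Algebra R C]

/-! ## Evaluation of rational maps at points of algebras -/

/-! A map acts as a partial function on `B`-valued points, for every `R`-algebra `B`: it is defined
at `x` when every `u` in its restriction set has `u(x)` invertible, and its value is then obtained
by substitution. Nothing is lost by this (`Hom.ext_eval`): the coordinates in the ring of fractions
of `f` form a generic point, and agreement at the generic points of `f` and `g` forces equal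
restriction sets and equal fractions. The operations become the evident ones on partial functions
(`Hom.eval_comp`, `Hom.eval_pair`, `Hom.eval_add`, `Hom.eval_restrict`), so the restriction, product
and additive axioms are pointwise checks.

Differentiation becomes evaluation over the dual numbers (`Hom.eval_diff`): `f(x + εv) = f(x) + ε
J_f(x) v`, and definedness at `x + εv` is definedness at `x`, because a dual number is invertible
exactly when its constant part is. The chain rule is then just composition over `B[ε]`. Additivity
in the direction and DR.6 need in addition that the Jacobian is a matrix over `B` compatible with
homomorphisms (`Hom.DefinedAt.exists_jacobian`). DR.7, the symmetry of second derivatives, follows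
because evaluation commutes with the automorphism exchanging the two infinitesimals of the iterated
dual numbers (`ev_D_D_swap`). -/

theorem fracLift_comp {V : SaturatedSubmonoid (MvPolynomial (Fin n) R)}
    (χ : MvPolynomial (Fin n) R →ₐ[R] B) (h : ∀ v ∈ V, IsUnit (χ v)) (φ : B →ₐ[R] C)
    (χ' : MvPolynomial (Fin n) R →ₐ[R] C) (h' : ∀ v ∈ V, IsUnit (χ' v))
    (hχ : ∀ i, χ' (X i) = φ (χ (X i))) (z : Frac V) :
    fracLift χ' h' z = φ (fracLift χ h z) :=
  fracAlgHom_ext (fracLift χ' h') (φ.comp (fracLift χ h)) (fun i => by simp [hχ]) z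

namespace Hom

/-- The map `f` is defined at the point `x`. -/
abbrev DefinedAt (f : Hom R n m) (x : Fin n → B) : Prop := ∀ u ∈ f.rset, IsUnit (aeval x u)

/-- The map `f` is defined at the point `x` and has the value `y` there. -/
def Eval (f : Hom R n m) (x : Fin n → B) (y : Fin m → B) : Prop :=
  ∃ h : f.DefinedAt x, ∀ j, fracLift (aeval x) h (f.fn j) = y j

theorem Eval.definedAt {f : Hom R n m} {x : Fin n → B} {y : Fin m → B} (h : f.Eval x y) :
    f.DefinedAt x := h.1

theorem DefinedAt.exists_eval {f : Hom R n m} {x : Fin n → B} (h : f.DefinedAt x) :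
    ∃ y, f.Eval x y := ⟨_, h, fun _ => rfl⟩

theorem Eval.unique {f : Hom R n m} {x : Fin n → B} {y y' : Fin m → B} (h : f.Eval x y)
    (h' : f.Eval x y') : y = y' := by
  funext j
  rw [← h.2 j, ← h'.2 j]

theorem Eval.eq_iff {f : Hom R n m} {x : Fin n → B} {y y' : Fin m → B} (h : f.Eval x y) :
    f.Eval x y' ↔ y' = y :=
  ⟨fun h' => h'.unique h, fun e => e ▸ h⟩

theorem Eval.map {f : Hom R n m} {x : Fin n → B} {y : Fin m → B} (h : f.Eval x y)
    (φ : B →ₐ[R] C) : f.Eval (fun i => φ (x i)) (fun j => φ (y j)) := by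
  have h' : f.DefinedAt (fun i => φ (x i)) := fun u hu => by
    have := (h.1 u hu).map φ
    rwa [← AlgHom.comp_apply, comp_aeval] at this
  exact ⟨h', fun j =>
    (fracLift_comp _ h.1 φ _ _ (fun i => by simp) _).trans (congrArg φ (h.2 j))⟩

/-- At the generic point of `f`, evaluation is the canonical map to the fractions over `f.rset`.
Because `f.rset` is factor closed, a polynomial becomes invertible there only if it already lies in
`f.rset`; hence definedness of `g` there is an inclusion of restriction sets. -/
theorem le_of_eval {f g : Hom R n m}
    (h : g.Eval (fun i => fracOf f.rset (X i)) f.fn) :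
    ∃ hle : g.rset ≤ f.rset, ∀ i, fracMap hle (g.fn i) = f.fn i := by
  obtain ⟨h1, h2⟩ := h
  have e : aeval (fun i => fracOf f.rset (X i)) = fracOf f.rset :=
    MvPolynomial.algHom_ext fun i => by simp
  have hle : g.rset ≤ f.rset := le_iff_isUnit.2 fun u hu => by
    have := h1 u hu
    rwa [e] at this
  refine ⟨hle, fun i => ?_⟩
  rw [← h2 i]
  exact fracAlgHom_ext (fracMap hle) (fracLift _ h1) (fun i => by
    rw [fracMap_fracOf, fracLift_fracOf, aeval_X]) _

theorem eval_generic (f : Hom R n m) : f.Eval (fun i => fracOf f.rset (X i)) f.fn := by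
  have e : aeval (fun i => fracOf f.rset (X i)) = fracOf f.rset :=
    MvPolynomial.algHom_ext fun i => by simp
  have h : f.DefinedAt (fun i => fracOf f.rset (X i)) := fun u hu => by
    rw [e]; exact isUnit_frac.2 hu
  exact ⟨h, fun j => fracAlgHom_ext (fracLift _ h) (AlgHom.id R _)
    (fun i => by rw [fracLift_fracOf, aeval_X]; rfl) _⟩

/-- Maps are determined by their values at all points of all algebras. -/
theorem ext_eval {f g : Hom R n m}
    (h : ∀ (B : Type u) [CommRing B] [Algebra R B] (x : Fin n → B) (y : Fin m → B),
      f.Eval x y ↔ g.Eval x y) : f = g := by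
  obtain ⟨h1, h2⟩ := le_of_eval ((h _ _ _).1 f.eval_generic)
  obtain ⟨h3, h4⟩ := le_of_eval ((h _ _ _).2 g.eval_generic)
  exact ext_of_eq (le_antisymm h3 h1) h4

theorem eval_ofPoly {p : Fin m → MvPolynomial (Fin n) R} {x : Fin n → B} {y : Fin m → B} :
    (ofPoly p).Eval x y ↔ y = fun j => aeval x (p j) := by
  -- The set `⊥` consists of the units of the polynomial ring, so it imposes no condition on `x`.
  have h : (ofPoly p).DefinedAt x := fun u hu => (SaturatedSubmonoid.mem_bot_iff.1 hu).map _
  constructor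
  · rintro ⟨_, h2⟩
    funext j
    rw [← h2 j]
    exact fracLift_fracOf _ _ _
  · rintro rfl
    exact ⟨h, fun j => fracLift_fracOf _ _ _⟩

theorem fracLift_subst (f : Hom R n m) {x : Fin n → B} {y : Fin m → B} (h : f.DefinedAt x)
    (hy : ∀ j, fracLift (aeval x) h (f.fn j) = y j) :
    (fracLift (aeval x) h).comp f.subst = aeval y :=
  MvPolynomial.algHom_ext fun i => by simp [hy]

/-- A numerator of `v(f)` becomes invertible at `x` exactly when `v(f)` does, since the denominators
are invertible there. Thus the restriction set of the composite says precisely that `f` is defined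
at `x` and `g` at the value. -/
theorem eval_comp {f : Hom R n m} {g : Hom R m k} {x : Fin n → B} {z : Fin k → B} :
    (f.comp g).Eval x z ↔ ∃ y, f.Eval x y ∧ g.Eval y z := by
  have key : ∀ (h1 : f.DefinedAt x) (y : Fin m → B),
      (∀ j, fracLift (aeval x) h1 (f.fn j) = y j) →
      ((f.comp g).DefinedAt x ↔ g.DefinedAt y) := fun h1 y hy => by
    refine (f.compSet_isUnit_iff (aeval x) h1).trans (forall₂_congr fun v _ => ?_)
    rw [← f.fracLift_subst h1 hy]
    rfl
  have key2 : ∀ (h1 : f.DefinedAt x) (y : Fin m → B)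
      (hy : ∀ j, fracLift (aeval x) h1 (f.fn j) = y j)
      (h2 : (f.comp g).DefinedAt x) (h3 : g.DefinedAt y) (j : Fin k),
      fracLift (aeval x) h2 ((f.comp g).fn j) = fracLift (aeval y) h3 (g.fn j) := by
    intro h1 y hy h2 h3 j
    refine fracAlgHom_ext ((fracLift (aeval x) h2).comp (f.fracSubst g.rset)) (fracLift _ h3)
      (fun i => ?_) (g.fn j)
    refine (congrArg (fracLift (aeval x) h2) (f.fracSubst_fracOf _ _)).trans ?_
    rw [subst_X, fracLift_fracOf, aeval_X, ← hy i]
    exact fracLift_fracMap _ _ _ _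
  constructor
  · rintro ⟨h, hz⟩
    have h1 : f.DefinedAt x := fun u hu => h u (f.le_compSet _ hu)
    refine ⟨_, ⟨h1, fun _ => rfl⟩, (key h1 _ fun _ => rfl).1 h, fun j => ?_⟩
    rw [← hz j, key2 h1 _ (fun _ => rfl)]
  · rintro ⟨y, ⟨h1, hy⟩, h3, hz⟩
    refine ⟨(key h1 y hy).2 h3, fun j => ?_⟩
    rw [← hz j, key2 h1 y hy _ h3]

theorem eval_restrict {f : Hom R n m} {x x' : Fin n → B} :
    f.restrict.Eval x x' ↔ x' = x ∧ ∃ y, f.Eval x y := by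
  constructor
  · rintro ⟨h, h2⟩
    refine ⟨funext fun j => ?_, DefinedAt.exists_eval h⟩
    rw [← h2 j]
    exact (fracLift_fracOf _ _ _).trans (aeval_X _ _)
  · rintro ⟨rfl, y, h⟩
    exact ⟨h.1, fun j => (fracLift_fracOf _ _ _).trans (aeval_X _ _)⟩

/-- The polynomials invertible at `x` themselves form a factor closed multiplicative set, so this is
the universal property of the join. -/
theorem forall_isUnit_sup {U V : SaturatedSubmonoid (MvPolynomial (Fin n) R)} {x : Fin n → B} :
    (∀ u ∈ U ⊔ V, IsUnit (aeval x u)) ↔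
      (∀ u ∈ U, IsUnit (aeval x u)) ∧ ∀ u ∈ V, IsUnit (aeval x u) :=
  sup_le_iff (c := unitSet (aeval x : MvPolynomial (Fin n) R →ₐ[R] B))

theorem pair_fn_castAdd (f : Hom R k n) (g : Hom R k m) (i : Fin n) :
    (f.pair g).fn (Fin.castAdd m i) =
      fracMap (le_sup_left : f.rset ≤ f.rset ⊔ g.rset) (f.fn i) :=
  Fin.append_left (fun i => fracMap (le_sup_left : f.rset ≤ f.rset ⊔ g.rset) (f.fn i))
    (fun i => fracMap le_sup_right (g.fn i)) i

theorem pair_fn_natAdd (f : Hom R k n) (g : Hom R k m) (i : Fin m) :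
    (f.pair g).fn (Fin.natAdd n i) =
      fracMap (le_sup_right : g.rset ≤ f.rset ⊔ g.rset) (g.fn i) :=
  Fin.append_right (fun i => fracMap (le_sup_left : f.rset ≤ f.rset ⊔ g.rset) (f.fn i))
    (fun i => fracMap le_sup_right (g.fn i)) i

theorem eval_pair {f : Hom R k n} {g : Hom R k m} {x : Fin k → B} {p : Fin (n + m) → B} :
    (f.pair g).Eval x p ↔ ∃ y z, p = Fin.append y z ∧ f.Eval x y ∧ g.Eval x z := by
  constructor
  · rintro ⟨h, hp⟩
    obtain ⟨h1, h2⟩ := forall_isUnit_sup.1 h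
    refine ⟨_, _, ?_, ⟨h1, fun _ => rfl⟩, ⟨h2, fun _ => rfl⟩⟩
    funext j
    rw [← hp j]
    induction j using Fin.addCases with
    | left i =>
      rw [Fin.append_left, ← fracLift_fracMap le_sup_left _ h]
      exact congrArg (fracLift (aeval x) h) (f.pair_fn_castAdd g i)
    | right i =>
      rw [Fin.append_right, ← fracLift_fracMap le_sup_right _ h]
      exact congrArg (fracLift (aeval x) h) (f.pair_fn_natAdd g i)
  · rintro ⟨y, z, rfl, ⟨h1, hy⟩, ⟨h2, hz⟩⟩
    have h := forall_isUnit_sup.2 ⟨h1, h2⟩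
    refine ⟨h, fun j => ?_⟩
    induction j using Fin.addCases with
    | left i =>
      rw [Fin.append_left, ← hy, ← fracLift_fracMap le_sup_left _ h]
      exact congrArg (fracLift (aeval x) h) (f.pair_fn_castAdd g i)
    | right i =>
      rw [Fin.append_right, ← hz, ← fracLift_fracMap le_sup_right _ h]
      exact congrArg (fracLift (aeval x) h) (f.pair_fn_natAdd g i)

theorem eval_add {f g : Hom R n m} {x : Fin n → B} {w : Fin m → B} :
    (f.add g).Eval x w ↔ ∃ y z, w = y + z ∧ f.Eval x y ∧ g.Eval x z := by
  constructor
  · rintro ⟨h, hw⟩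
    obtain ⟨h1, h2⟩ := forall_isUnit_sup.1 h
    refine ⟨_, _, ?_, ⟨h1, fun _ => rfl⟩, ⟨h2, fun _ => rfl⟩⟩
    funext j
    rw [← hw j, Pi.add_apply, ← fracLift_fracMap le_sup_left _ h,
      ← fracLift_fracMap le_sup_right _ h]
    exact map_add (fracLift (aeval x) h) _ _
  · rintro ⟨y, z, rfl, ⟨h1, hy⟩, ⟨h2, hz⟩⟩
    have h := forall_isUnit_sup.2 ⟨h1, h2⟩
    refine ⟨h, fun j => ?_⟩
    rw [Pi.add_apply, ← hy, ← hz, ← fracLift_fracMap le_sup_left _ h,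
      ← fracLift_fracMap le_sup_right _ h]
    exact map_add (fracLift (aeval x) h) _ _

/-! ## Differentials and dual numbers -/

/-- First order Taylor expansion, exact because `ε² = 0`. The induction step for multiplication by a
variable is the Leibniz rule. -/
theorem aeval_dual (x v : Fin n → B) (p : MvPolynomial (Fin n) R) :
    aeval (fun i => (TrivSqZeroExt.inl (x i) + TrivSqZeroExt.inr (v i) : DualNumber B)) p =
      TrivSqZeroExt.inl (aeval x p) +
        TrivSqZeroExt.inr (∑ i, aeval x (pderiv i p) * v i) := by
  induction p using MvPolynomial.induction_on with
  | C a =>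
    ext <;> simp [TrivSqZeroExt.algebraMap_eq_inl']
  | add p q hp hq =>
    rw [map_add, hp, hq]
    ext <;> simp [add_mul, Finset.sum_add_distrib]
  | mul_X p j hp =>
    rw [map_mul, hp]
    ext
    · simp
    · simp [pderiv_X, Pi.single_apply, add_mul, Finset.sum_add_distrib, apply_ite]
      rw [Finset.sum_mul]
      exact Finset.sum_congr rfl fun i _ => by ring

theorem isUnit_dual {z : DualNumber B} : IsUnit z ↔ IsUnit z.fst :=
  TrivSqZeroExt.isUnit_iff_isUnit_fst

theorem definedAt_dual {f : Hom R n m} {x v : Fin n → B} :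
    f.DefinedAt (fun i => (TrivSqZeroExt.inl (x i) + TrivSqZeroExt.inr (v i) : DualNumber B)) ↔
      f.DefinedAt x :=
  forall₂_congr fun u _ => by rw [aeval_dual, isUnit_dual]; simp

/-- The quotient rule with its denominator cleared, so that it can be transported along
homomorphisms. -/
theorem fracPderiv_mul_sq {U : SaturatedSubmonoid (MvPolynomial (Fin n) R)} (i : Fin n)
    (p : MvPolynomial (Fin n) R) (q : U.toSubmonoid) :
    fracPderiv i (Localization.mk p q : Frac U) * fracOf U q ^ 2 =
      fracOf U (pderiv i p * q - p * pderiv i (q : MvPolynomial (Fin n) R)) := by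
  rw [← map_pow]
  exact mk_mul_fracOf _ (q ^ 2)

/-- The value `Z` of `p/q` at `x + εv` satisfies `Z · q(x + εv) = p(x + εv)`. Both sides are known
from the polynomial case, and invertibility of `q(x)` lets one solve for the constant and the
infinitesimal part of `Z`; the latter is the quotient rule. -/
theorem fracLift_dual {U : SaturatedSubmonoid (MvPolynomial (Fin n) R)} {x v : Fin n → B}
    (h : ∀ u ∈ U, IsUnit (aeval x u))
    (h' : ∀ u ∈ U, IsUnit (aeval (fun i =>
      (TrivSqZeroExt.inl (x i) + TrivSqZeroExt.inr (v i) : DualNumber B)) u)) (z : Frac U) :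
    fracLift (aeval _) h' z = TrivSqZeroExt.inl (fracLift (aeval x) h z) +
      TrivSqZeroExt.inr (∑ i, fracLift (aeval x) h (fracPderiv i z) * v i) := by
  obtain ⟨p, q, rfl⟩ := exists_mk z
  have hq := h q q.2
  have e := congrArg (fracLift (aeval _) h') (mk_mul_fracOf p q)
  have e0 := congrArg (fracLift (aeval x) h) (mk_mul_fracOf p q)
  have ei := fun i => congrArg (fracLift (aeval x) h) (fracPderiv_mul_sq i p q)
  simp only [map_mul, fracLift_fracOf, map_sub, map_pow] at e e0 ei
  rw [aeval_dual, aeval_dual] at e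
  generalize fracLift (aeval _) h' (Localization.mk p q) = Z at *
  have e1 := congrArg TrivSqZeroExt.fst e
  have e2 := congrArg TrivSqZeroExt.snd e
  simp at e1 e2
  have hZ : Z.fst = fracLift (aeval x) h (Localization.mk p q) :=
    hq.mul_right_cancel (by rw [e1, e0])
  ext
  · simp [hZ]
  -- Multiplying by the unit `q(x)²` turns the partial derivatives into the polynomial expressions
  -- of `ei`.
  · refine (hq.pow 2).mul_right_cancel ?_
    have : (∑ i, fracLift (aeval x) h (fracPderiv i (Localization.mk p q)) * v i) * aeval x q.1 ^ 2
        = (∑ i, aeval x (pderiv i p) * v i) * aeval x q.1 -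
          aeval x p * ∑ i, aeval x (pderiv i q.1) * v i := by
      simp only [Finset.sum_mul, Finset.mul_sum, ← Finset.sum_sub_distrib]
      refine Finset.sum_congr rfl fun i _ => ?_
      linear_combination v i * ei i
    simp only [TrivSqZeroExt.snd_add, TrivSqZeroExt.snd_inl, TrivSqZeroExt.snd_inr, zero_add]
    rw [this, ← e2]
    linear_combination (-(∑ i, aeval x (pderiv i q.1) * v i)) * e1

theorem definedAt_diff {f : Hom R n m} {x v : Fin n → B} :
    f.diff.DefinedAt (Fin.append v x) ↔ f.DefinedAt x := by
  have e : ∀ p, aeval (Fin.append v x) (shiftVars R n p) = aeval x p := fun p => by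
    rw [shiftVars, aeval_rename]
    congr 2
    exact funext fun i => Fin.append_right _ _ i
  refine (genBy_le (U := unitSet (aeval (Fin.append v x) : _ →ₐ[R] B))).trans ?_
  constructor
  · intro h u hu
    have := h _ ⟨u, hu, rfl⟩
    rw [← e]
    exact this
  · rintro h _ ⟨u, hu, rfl⟩
    have := h u hu
    rw [← e] at this
    exact this

theorem fracLift_fracShift {U : SaturatedSubmonoid (MvPolynomial (Fin n) R)} {x v : Fin n → B}
    (h : ∀ u ∈ U, IsUnit (aeval x u))
    (h' : ∀ u ∈ shiftSet U, IsUnit (aeval (Fin.append v x) u)) (z : Frac U) :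
    fracLift (aeval (Fin.append v x)) h' (fracShift U z) = fracLift (aeval x) h z :=
  fracAlgHom_ext ((fracLift (aeval _) h').comp (fracShift U)) _ (fun i => by
    have e : fracShift U (fracOf U (X i)) = fracOf _ (shiftVars R n (X i)) :=
      fracLift_fracOf _ _ _
    rw [AlgHom.comp_apply, e, fracLift_fracOf, fracLift_fracOf, shiftVars, rename_X, aeval_X,
      aeval_X, Fin.append_right]) z

theorem fracLift_shift_sum {U : SaturatedSubmonoid (MvPolynomial (Fin n) R)} {x v : Fin n → B}
    (h : ∀ u ∈ U, IsUnit (aeval x u))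
    (h' : ∀ u ∈ shiftSet U, IsUnit (aeval (Fin.append v x) u)) (c : Fin n → Frac U) :
    fracLift (aeval (Fin.append v x)) h'
        (∑ i, fracShift U (c i) * fracOf (shiftSet U) (X (Fin.castAdd n i))) =
      ∑ i, fracLift (aeval x) h (c i) * v i := by
  rw [map_sum]
  refine Finset.sum_congr rfl fun i _ => ?_
  rw [map_mul, fracLift_fracShift h, fracLift_fracOf, aeval_X, Fin.append_left]

theorem fracLift_diff {f : Hom R n m} {x v : Fin n → B} (h : f.DefinedAt x)
    (h' : f.diff.DefinedAt (Fin.append v x)) (j : Fin m) :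
    fracLift (aeval _) h' (f.diff.fn j) =
      ∑ i, fracLift (aeval x) h (fracPderiv i (f.fn j)) * v i :=
  fracLift_shift_sum h h' _

theorem eval_diff_iff {f : Hom R n m} {x v : Fin n → B} {w : Fin m → B} (h : f.DefinedAt x) :
    f.diff.Eval (Fin.append v x) w ↔
      w = fun j => ∑ i, fracLift (aeval x) h (fracPderiv i (f.fn j)) * v i := by
  have h' : f.diff.DefinedAt (Fin.append v x) := definedAt_diff.2 h
  exact Eval.eq_iff ⟨h', fracLift_diff h h'⟩

/-- The value of the differential at `(v, x)` is a linear function of `v`, with coefficients which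
are compatible with all homomorphisms. -/
theorem DefinedAt.exists_jacobian {f : Hom R n m} {x : Fin n → B} (h : f.DefinedAt x) :
    ∃ c : Fin m → Fin n → B, ∀ (C : Type u) [CommRing C] [Algebra R C] (φ : B →ₐ[R] C)
      (v : Fin n → C) (w : Fin m → C), f.diff.Eval (Fin.append v fun i => φ (x i)) w ↔
        w = fun j => ∑ i, φ (c j i) * v i := by
  -- The coefficients are the entries of the formal Jacobian at `x`; `fracLift_comp` makes them
  -- compatible with `φ`.
  refine ⟨fun j i => fracLift (aeval x) h (fracPderiv i (f.fn j)), fun C _ _ φ v w => ?_⟩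
  obtain ⟨y, hy⟩ := h.exists_eval
  have h1 : f.DefinedAt (fun i => φ (x i)) := (hy.map φ).definedAt
  rw [eval_diff_iff h1]
  have e : ∀ z, fracLift (aeval fun i => φ (x i)) h1 z = φ (fracLift (aeval x) h z) :=
    fracLift_comp (aeval x) h φ _ h1 (fun i => by rw [aeval_X, aeval_X])
  simp only [e]

/-- The differential of `f` is the infinitesimal part of `f` over the dual numbers. -/
theorem eval_diff {f : Hom R n m} {x v : Fin n → B} {w : Fin m → B} :
    f.diff.Eval (Fin.append v x) w ↔ ∃ y : Fin m → B, f.Eval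
      (fun i => (TrivSqZeroExt.inl (x i) + TrivSqZeroExt.inr (v i) : DualNumber B))
      (fun j => TrivSqZeroExt.inl (y j) + TrivSqZeroExt.inr (w j)) := by
  constructor
  · rintro ⟨h', hw⟩
    have h := definedAt_diff.1 h'
    refine ⟨fun j => fracLift (aeval x) h (f.fn j), definedAt_dual.2 h, fun j => ?_⟩
    rw [fracLift_dual h, ← fracLift_diff h h', hw]
  · rintro ⟨y, h', hw⟩
    have h := definedAt_dual.1 h'
    refine ⟨definedAt_diff.2 h, fun j => ?_⟩
    have := congrArg TrivSqZeroExt.snd (hw j)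
    rw [fracLift_dual h] at this
    rw [fracLift_diff h]
    simpa using this

end Hom
end

section

section Points

variable {R : Type u} {B : Type u} {X Y : RatCat R}

/-! ## Points of objects -/

/-- The `B`-valued points of an object. -/
abbrev Pt (B : Type u) (X : RatCat R) : Type u := Fin X.dim → B

section

variable [CommRing B]

/-- The point `x + ε v` over the dual numbers. -/
def dual (x v : Pt B X) : Pt (DualNumber B) X :=
  fun i => TrivSqZeroExt.inl (x i) + TrivSqZeroExt.inr (v i)

theorem exists_dual (p : Pt (DualNumber B) X) : ∃ x v : Pt B X, p = dual x v :=
  ⟨fun i => (p i).fst, fun i => (p i).snd,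
    funext fun i => (TrivSqZeroExt.inl_fst_add_inr_snd_eq (p i)).symm⟩

@[simp]
theorem dual_inj {x v x' v' : Pt B X} : dual x v = dual x' v' ↔ x = x' ∧ v = v' := by
  refine ⟨fun h => ⟨funext fun i => ?_, funext fun i => ?_⟩, fun h => h.1 ▸ h.2 ▸ rfl⟩
  · simpa [dual] using congrArg TrivSqZeroExt.fst (congrFun h i)
  · simpa [dual] using congrArg TrivSqZeroExt.snd (congrFun h i)

theorem dual_add (x v x' v' : Pt B X) : dual x v + dual x' v' = dual (x + x') (v + v') := by
  funext i
  ext <;> simp [dual]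

theorem dual_zero : dual (0 : Pt B X) 0 = 0 := by
  funext i
  ext <;> simp [dual]

end

variable [CommRing R]

/-- The point of a product with given components. -/
def ptPair (x : Pt B X) (y : Pt B Y) : Pt B (prod X Y) :=
  Fin.append (m := X.dim) (n := Y.dim) x y

/-- The first component of a point of a product. -/
def ptFst (p : Pt B (prod X Y)) : Pt B X := fun i => p (Fin.castAdd Y.dim i)

/-- The second component of a point of a product. -/
def ptSnd (p : Pt B (prod X Y)) : Pt B Y := fun i => p (Fin.natAdd X.dim i)

@[simp]
theorem ptFst_ptPair (x : Pt B X) (y : Pt B Y) : ptFst (ptPair x y) = x :=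
  funext fun i => Fin.append_left (m := X.dim) (n := Y.dim) x y i

@[simp]
theorem ptSnd_ptPair (x : Pt B X) (y : Pt B Y) : ptSnd (ptPair x y) = y :=
  funext fun i => Fin.append_right (m := X.dim) (n := Y.dim) x y i

theorem ptPair_eta (p : Pt B (prod X Y)) : ptPair (ptFst p) (ptSnd p) = p :=
  Fin.append_castAdd_natAdd (m := X.dim) (n := Y.dim)

theorem exists_ptPair (p : Pt B (prod X Y)) : ∃ (x : Pt B X) (y : Pt B Y), p = ptPair x y :=
  ⟨_, _, (ptPair_eta p).symm⟩

@[simp]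
theorem ptPair_inj {x x' : Pt B X} {y y' : Pt B Y} :
    ptPair x y = ptPair x' y' ↔ x = x' ∧ y = y' := by
  refine ⟨fun h => ⟨?_, ?_⟩, fun h => h.1 ▸ h.2 ▸ rfl⟩
  · simpa using congrArg ptFst h
  · simpa using congrArg ptSnd h

section

variable [CommRing B]

@[simp]
theorem ptFst_add (p q : Pt B (prod X Y)) : ptFst (p + q) = ptFst p + ptFst q := rfl

@[simp]
theorem ptSnd_add (p q : Pt B (prod X Y)) : ptSnd (p + q) = ptSnd p + ptSnd q := rfl

theorem ptPair_add (x x' : Pt B X) (y y' : Pt B Y) :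
    ptPair (x + x') (y + y') = ptPair x y + ptPair x' y' := by
  rw [← ptPair_eta (ptPair x y + ptPair x' y')]
  simp

theorem ptPair_zero : ptPair (0 : Pt B X) (0 : Pt B Y) = 0 := ptPair_eta 0

theorem dual_ptPair (x v : Pt B X) (y w : Pt B Y) :
    dual (ptPair x y) (ptPair v w) = ptPair (dual x v) (dual y w) := by
  rw [← ptPair_eta (dual (ptPair x y) (ptPair v w)), ptPair_inj]
  constructor
  · funext i
    change _ = TrivSqZeroExt.inl (x i) + TrivSqZeroExt.inr (v i)
    rw [← congrFun (ptFst_ptPair x y) i, ← congrFun (ptFst_ptPair v w) i]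
    rfl
  · funext i
    change _ = TrivSqZeroExt.inl (y i) + TrivSqZeroExt.inr (w i)
    rw [← congrFun (ptSnd_ptPair x y) i, ← congrFun (ptSnd_ptPair v w) i]
    rfl

@[simp]
theorem ptFst_dual (p q : Pt B (prod X Y)) : ptFst (dual p q) = dual (ptFst p) (ptFst q) := rfl

@[simp]
theorem ptSnd_dual (p q : Pt B (prod X Y)) : ptSnd (dual p q) = dual (ptSnd p) (ptSnd q) := rfl

end

end Points

variable {R : Type u} [CommRing R]
variable {B C : Type u} [CommRing B] [Algebra R B] [CommRing C] [Algebra R C]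
variable {X Y Z : RatCat R}

/-! ## The operations of the category in terms of points -/

/-- The map `f` is defined at the point `x` and has the value `y` there. -/
def Ev (f : X ⟶ Y) (x : Pt B X) (y : Pt B Y) : Prop :=
  Hom.Eval (n := X.dim) (m := Y.dim) f x y

theorem ext_ev {f g : X ⟶ Y}
    (h : ∀ (B : Type u) [CommRing B] [Algebra R B] (x : Pt B X) (y : Pt B Y),
      Ev f x y ↔ Ev g x y) : f = g :=
  Hom.ext_eval (n := X.dim) (m := Y.dim) h

theorem Ev.unique {f : X ⟶ Y} {x : Pt B X} {y y' : Pt B Y} (h : Ev f x y) (h' : Ev f x y') :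
    y = y' := Hom.Eval.unique h h'

theorem Ev.map {f : X ⟶ Y} {x : Pt B X} {y : Pt B Y} (h : Ev f x y) (φ : B →ₐ[R] C) :
    Ev f (fun i => φ (x i)) (fun j => φ (y j)) := Hom.Eval.map h φ

@[simp]
theorem ev_id {x y : Pt B X} : Ev (𝟙 X) x y ↔ y = x :=
  Hom.eval_ofPoly.trans (by simp)

@[simp]
theorem ev_comp {f : X ⟶ Y} {g : Y ⟶ Z} {x : Pt B X} {z : Pt B Z} :
    Ev (f ≫ g) x z ↔ ∃ y, Ev f x y ∧ Ev g y z := Hom.eval_comp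

@[simp]
theorem ev_rst {f : X ⟶ Y} {x x' : Pt B X} :
    Ev (rst f) x x' ↔ x' = x ∧ ∃ y, Ev f x y := Hom.eval_restrict

@[simp]
theorem ev_bang {x : Pt B X} {y : Pt B (one : RatCat R)} : Ev (bang X) x y :=
  Hom.eval_ofPoly.2 (funext fun i => Fin.elim0 i)

@[simp]
theorem ev_fst {p : Pt B (prod X Y)} {x : Pt B X} : Ev (fst X Y) p x ↔ x = ptFst p :=
  Hom.eval_ofPoly.trans (by simp only [aeval_X]; rfl)

@[simp]
theorem ev_snd {p : Pt B (prod X Y)} {y : Pt B Y} : Ev (snd X Y) p y ↔ y = ptSnd p :=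
  Hom.eval_ofPoly.trans (by simp only [aeval_X]; rfl)

@[simp]
theorem ev_pair {f : Z ⟶ X} {g : Z ⟶ Y} {z : Pt B Z} {p : Pt B (prod X Y)} :
    Ev (pair f g) z p ↔ ∃ x y, p = ptPair x y ∧ Ev f z x ∧ Ev g z y := Hom.eval_pair

@[simp]
theorem ev_add {f g : X ⟶ Y} {x : Pt B X} {w : Pt B Y} :
    Ev (f + g) x w ↔ ∃ y z, w = y + z ∧ Ev f x y ∧ Ev g x z := Hom.eval_add

@[simp]
theorem ev_zero {x : Pt B X} {y : Pt B Y} : Ev (0 : X ⟶ Y) x y ↔ y = 0 :=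
  Hom.eval_ofPoly.trans (by simp only [Pi.zero_apply, map_zero]; rfl)

@[simp]
theorem ev_prodMap {X' Y' : RatCat R} {f : X ⟶ X'} {g : Y ⟶ Y'} {x : Pt B X} {y : Pt B Y}
    {q : Pt B (prod X' Y')} :
    Ev (prodMap f g) (ptPair x y) q ↔ ∃ x' y', q = ptPair x' y' ∧ Ev f x x' ∧ Ev g y y' := by
  simp [prodMap]

/-! ### Domain and linearity of the differential in terms of points -/

/-- The differential of `f` is the infinitesimal part of `f` over the dual numbers. -/
theorem ev_D {f : X ⟶ Y} {x v : Pt B X} {w : Pt B Y} :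
    Ev (D f) (ptPair v x) w ↔ ∃ y, Ev f (dual x v) (dual y w) := Hom.eval_diff

/-- Apply the homomorphism `B[ε] → B` that sends `ε` to `0`. -/
theorem Ev.of_dual {f : X ⟶ Y} {x v : Pt B X} {y w : Pt B Y} (h : Ev f (dual x v) (dual y w)) :
    Ev f x y := by
  have := h.map (TrivSqZeroExt.fstHom R B B)
  simpa [dual] using this

/-- Definedness lifts from `x` to `x + εv`, and the constant part of the value is forced by
`Ev.of_dual` and uniqueness. -/
theorem Ev.exists_dual {f : X ⟶ Y} {x : Pt B X} {y : Pt B Y} (h : Ev f x y) (v : Pt B X) :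
    ∃ w, Ev f (dual x v) (dual y w) := by
  obtain ⟨p, hp⟩ := Hom.DefinedAt.exists_eval
    ((Hom.definedAt_dual (x := x) (v := v)).2 (Hom.Eval.definedAt h))
  obtain ⟨y', w, rfl⟩ := RatCat.exists_dual (X := Y) p
  have hp : Ev f (dual x v) (dual y' w) := hp
  obtain rfl := h.unique hp.of_dual
  exact ⟨w, hp⟩

theorem Ev.of_D {f : X ⟶ Y} {x v : Pt B X} {w : Pt B Y} (h : Ev (D f) (ptPair v x) w) :
    ∃ y, Ev f x y := by
  obtain ⟨y, hy⟩ := ev_D.1 h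
  exact ⟨y, hy.of_dual⟩

theorem Ev.exists_D {f : X ⟶ Y} {x : Pt B X} {y : Pt B Y} (h : Ev f x y) (v : Pt B X) :
    ∃ w, Ev (D f) (ptPair v x) w := by
  obtain ⟨w, hw⟩ := h.exists_dual v
  exact ⟨w, ev_D.2 ⟨y, hw⟩⟩

/-- The value of the differential at `(v, x)` is a linear function of `v`, with coefficients which
are compatible with all homomorphisms. -/
theorem Ev.exists_jacobian {f : X ⟶ Y} {x : Pt B X} {y : Pt B Y} (h : Ev f x y) :
    ∃ c : Fin Y.dim → Fin X.dim → B, ∀ (C : Type u) [CommRing C] [Algebra R C] (φ : B →ₐ[R] C)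
      (v : Pt C X) (w : Pt C Y), Ev (D f) (ptPair v fun i => φ (x i)) w ↔
        w = fun j => ∑ i, φ (c j i) * v i :=
  Hom.DefinedAt.exists_jacobian (Hom.Eval.definedAt h)

/-- Both differentials are given by one Jacobian, since they share the base point `x`. -/
theorem Ev.D_add {f : X ⟶ Y} {x v v' : Pt B X} {w w' : Pt B Y} (h : Ev (D f) (ptPair v x) w)
    (h' : Ev (D f) (ptPair v' x) w') : Ev (D f) (ptPair (v + v') x) (w + w') := by
  obtain ⟨y, hy⟩ := h.of_D
  obtain ⟨c, hc⟩ := hy.exists_jacobian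
  have hc := hc B (AlgHom.id R B)
  simp only [AlgHom.id_apply] at hc
  rw [hc] at *
  subst h h'
  funext j
  simp [mul_add, Finset.sum_add_distrib]

theorem Ev.D_zero {f : X ⟶ Y} {x : Pt B X} {y : Pt B Y} (h : Ev f x y) :
    Ev (D f) (ptPair 0 x) 0 := by
  obtain ⟨c, hc⟩ := h.exists_jacobian
  refine (hc B (AlgHom.id R B) 0 0).2 ?_
  funext j
  simp

/-! ### Second differentials at points -/

theorem dual_zero_right (x : Pt B X) :
    dual x 0 = fun i => TrivSqZeroExt.inlAlgHom R B B (x i) := by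
  funext i
  simp [dual]

/-- The second differential here is the infinitesimal part of `D f` at direction `h + εg` and
constant base point `k`. The Jacobian there is `J(k)`, without infinitesimal part, so the value is
`J(k)h + ε J(k)g`; hence `h` plays no role. -/
theorem ev_D_D_fst {f : X ⟶ Y} {g h k : Pt B X} {w : Pt B Y} :
    Ev (D (D f)) (ptPair (ptPair g 0) (ptPair h k)) w ↔ Ev (D f) (ptPair g k) w := by
  -- The Jacobian exists only where `f` is defined at `k`; each side of the equivalence implies
  -- this.
  have key : ∀ y, Ev f k y → (Ev (D (D f)) (ptPair (ptPair g 0) (ptPair h k)) w ↔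
      Ev (D f) (ptPair g k) w) := by
    intro y hy
    obtain ⟨c, hc⟩ := hy.exists_jacobian
    have h1 := hc B (AlgHom.id R B) g w
    have h2 := fun z => hc (DualNumber B) (TrivSqZeroExt.inlAlgHom R B B) (dual h g) (dual z w)
    simp only [AlgHom.id_apply] at h1
    rw [← dual_zero_right k] at h2
    rw [h1, ev_D, dual_ptPair]
    simp only [h2]
    have e : (fun j => ∑ i, TrivSqZeroExt.inlAlgHom R B B (c j i) * dual h g i) =
        dual (X := Y) (fun j => ∑ i, c j i * h i) (fun j => ∑ i, c j i * g i) := by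
      funext j
      ext <;> simp [dual, TrivSqZeroExt.fst_sum, TrivSqZeroExt.snd_sum]
    rw [e]
    simp
  constructor
  · intro H
    obtain ⟨y, hy⟩ := H.of_D
    obtain ⟨z, hz⟩ := hy.of_D
    exact (key z hz).1 H
  · intro H
    obtain ⟨z, hz⟩ := H.of_D
    exact (key z hz).2 H

/-- The exchange of the two infinitesimals of the iterated dual numbers. -/
def dualExchange {B : Type u} (z : DualNumber (DualNumber B)) : DualNumber (DualNumber B) :=
  ((z.fst.fst, z.snd.fst), (z.fst.snd, z.snd.snd))

section

variable {B : Type u} (z : DualNumber (DualNumber B))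

@[simp]
theorem fst_fst_dualExchange : (dualExchange z).fst.fst = z.fst.fst := rfl

@[simp]
theorem fst_snd_dualExchange : (dualExchange z).fst.snd = z.snd.fst := rfl

@[simp]
theorem snd_fst_dualExchange : (dualExchange z).snd.fst = z.fst.snd := rfl

@[simp]
theorem snd_snd_dualExchange : (dualExchange z).snd.snd = z.snd.snd := rfl

end

/-- The exchange of the two infinitesimals as a homomorphism of algebras. -/
def dualSwap (R B : Type u) [CommRing R] [CommRing B] [Algebra R B] :
    DualNumber (DualNumber B) →ₐ[R] DualNumber (DualNumber B) where
  toFun := dualExchange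
  map_one' := by ext <;> rfl
  map_zero' := by ext <;> rfl
  map_add' a b := by ext <;> rfl
  map_mul' a b := by
    ext
    all_goals simp
    ring
  commutes' r := by ext <;> rfl

/-- With infinitesimals `ε` and `ε'`, the hypothesis describes `f` at `k + εh + ε'g`, with `w` the
coefficient of `εε'` in the value. The exchange of `ε` and `ε'` swaps `g` and `h` and fixes that
coefficient. -/
theorem ev_D_D_swap {f : X ⟶ Y} {g h k : Pt B X} {w : Pt B Y}
    (H : Ev (D (D f)) (ptPair (ptPair 0 h) (ptPair g k)) w) :
    Ev (D (D f)) (ptPair (ptPair 0 g) (ptPair h k)) w := by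
  obtain ⟨y, hy⟩ := ev_D.1 H
  rw [dual_ptPair] at hy
  obtain ⟨z, hz⟩ := ev_D.1 hy
  obtain ⟨a, b, rfl⟩ := exists_dual z
  have := hz.map (C := DualNumber (DualNumber B)) (dualSwap R B)
  have e : ∀ {Z : RatCat R} (a b c d : Pt B Z),
      (fun i => dualSwap R B (dual (dual a b) (dual c d) i)) = dual (dual a c) (dual b d) := by
    intro Z a b c d
    funext i
    change dualExchange _ = _
    ext <;> simp only [fst_fst_dualExchange, fst_snd_dualExchange, snd_fst_dualExchange,
      snd_snd_dualExchange] <;> simp [dual]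
  rw [e, e] at this
  -- The exchange also swaps the first order coefficients `y` and `b` of the value, so `b` takes the
  -- place of `y`.
  refine ev_D.2 ⟨b, ?_⟩
  rw [dual_ptPair]
  exact ev_D.2 ⟨_, this⟩

end

variable {R : Type u} [CommRing R]

/-! ## The axioms -/

instance isRestrictionCategory : IsRestrictionCategory (RatCat R) where
  rst_comp_self f := ext_ev fun B _ _ x y => by
    simp only [ev_comp, ev_rst]
    grind
  rst_comm f g := ext_ev fun B _ _ x y => by
    simp only [ev_comp, ev_rst]
    grind
  rst_rst_comp f g := ext_ev fun B _ _ x y => by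
    simp only [ev_comp, ev_rst]
    grind
  comp_rst f h := ext_ev fun B _ _ x y => by
    simp only [ev_comp, ev_rst]
    constructor
    · rintro ⟨y, hf, rfl, z, hz⟩
      exact ⟨x, ⟨rfl, z, _, hf, hz⟩, hf⟩
    · rintro ⟨_, ⟨rfl, z, y', hf', hz⟩, hf⟩
      obtain rfl := hf.unique hf'
      exact ⟨_, hf, rfl, z, hz⟩

theorem isTotalMap_iff {X Y : RatCat R} {f : X ⟶ Y} : IsTotalMap f ↔
    ∀ (B : Type u) [CommRing B] [Algebra R B] (x : Pt B X), ∃ y, Ev f x y := by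
  constructor
  · intro h B _ _ x
    have : Ev (rst f) x x := by
      rw [show rst f = 𝟙 X from h, ev_id]
    exact (ev_rst.1 this).2
  · intro h
    refine ext_ev fun B _ _ x y => ?_
    rw [ev_rst, ev_id, and_iff_left (h B x)]

instance isCartesianRestrictionCategory : IsCartesianRestrictionCategory (RatCat R) where
  bang_total X := isTotalMap_iff.2 fun B _ _ x => ⟨Fin.elim0, ev_bang⟩
  bang_unique {X} f hf := ext_ev fun B _ _ x y => by
    refine iff_of_true ?_ ev_bang
    obtain ⟨y', h⟩ := isTotalMap_iff.1 hf B x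
    rwa [show y = y' from funext fun i => Fin.elim0 i]
  bang_one := ext_ev fun B _ _ x y =>
    iff_of_true ev_bang (ev_id.2 (funext fun i => Fin.elim0 i))
  comp_bang f := ext_ev fun B _ _ x y => by
    simp
  fst_total X Y := isTotalMap_iff.2 fun B _ _ x => by simp
  snd_total X Y := isTotalMap_iff.2 fun B _ _ x => by simp
  pair_fst f g := ext_ev fun B _ _ x y => by
    simp only [ev_comp, ev_rst, ev_pair, ev_fst]
    constructor
    · rintro ⟨_, ⟨a, b, rfl, ha, hb⟩, rfl⟩
      exact ⟨x, ⟨rfl, _, a, b, rfl, ha, hb⟩, by simpa using ha⟩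
    · rintro ⟨_, ⟨rfl, _, a, b, rfl, ha, hb⟩, hy⟩
      exact ⟨_, ⟨y, b, rfl, hy, hb⟩, by simp⟩
  pair_snd f g := ext_ev fun B _ _ x y => by
    simp only [ev_comp, ev_rst, ev_pair, ev_snd]
    constructor
    · rintro ⟨_, ⟨a, b, rfl, ha, hb⟩, rfl⟩
      exact ⟨x, ⟨rfl, _, a, b, rfl, ha, hb⟩, by simpa using hb⟩
    · rintro ⟨_, ⟨rfl, _, a, b, rfl, ha, hb⟩, hy⟩
      exact ⟨_, ⟨a, y, rfl, ha, hy⟩, by simp⟩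
  rst_pair f g := ext_ev fun B _ _ x y => by
    simp only [ev_comp, ev_rst, ev_pair]
    constructor
    · rintro ⟨rfl, _, a, b, rfl, ha, hb⟩
      exact ⟨_, ⟨rfl, a, ha⟩, rfl, b, hb⟩
    · rintro ⟨_, ⟨rfl, a, ha⟩, rfl, b, hb⟩
      exact ⟨rfl, _, a, b, rfl, ha, hb⟩
  pair_unique {X Y Z} f g h h1 h2 h3 := ext_ev fun B _ _ x p => by
    have key : ∀ p, Ev h x p → Ev f x (ptFst p) ∧ Ev g x (ptSnd p) := by
      intro p hp
      have e1 : Ev (h ≫ fst X Y) x (ptFst p) := ev_comp.2 ⟨p, hp, ev_fst.2 rfl⟩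
      have e2 : Ev (h ≫ snd X Y) x (ptSnd p) := ev_comp.2 ⟨p, hp, ev_snd.2 rfl⟩
      rw [h1, ev_comp] at e1
      rw [h2, ev_comp] at e2
      simp only [ev_rst] at e1 e2
      grind
    rw [ev_pair]
    constructor
    · intro hp
      exact ⟨_, _, (ptPair_eta p).symm, key p hp⟩
    · rintro ⟨a, b, rfl, ha, hb⟩
      -- The projection equations only constrain values that `h` has; that `h` is defined at `x`
      -- comes from the condition on its restriction.
      have : Ev (rst h) x x := by
        rw [h3]
        exact ev_comp.2 ⟨x, ev_rst.2 ⟨rfl, a, ha⟩, ev_rst.2 ⟨rfl, b, hb⟩⟩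
      obtain ⟨-, q, hq⟩ := ev_rst.1 this
      obtain ⟨h4, h5⟩ := key q hq
      rwa [ha.unique h4, hb.unique h5, ptPair_eta]

instance isLeftAdditiveRestrictionCategory : IsLeftAdditiveRestrictionCategory (RatCat R) where
  hom_add_assoc f g h := ext_ev fun B _ _ x y => by
    simp only [ev_add]
    constructor
    · rintro ⟨_, c, rfl, ⟨a, b, rfl, ha, hb⟩, hc⟩
      exact ⟨a, _, add_assoc a b c, ha, b, c, rfl, hb, hc⟩
    · rintro ⟨a, _, rfl, ha, b, c, rfl, hb, hc⟩
      exact ⟨_, c, (add_assoc a b c).symm, ⟨a, b, rfl, ha, hb⟩, hc⟩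
  hom_add_comm f g := ext_ev fun B _ _ x y => by
    simp only [ev_add]
    constructor <;>
    · rintro ⟨a, b, rfl, ha, hb⟩
      exact ⟨b, a, add_comm a b, hb, ha⟩
  hom_zero_add f := ext_ev fun B _ _ x y => by
    simp
  rst_add f g := ext_ev fun B _ _ x y => by
    simp only [ev_comp, ev_rst, ev_add]
    constructor
    · rintro ⟨rfl, _, a, b, rfl, ha, hb⟩
      exact ⟨_, ⟨rfl, a, ha⟩, rfl, b, hb⟩
    · rintro ⟨_, ⟨rfl, a, ha⟩, rfl, b, hb⟩
      exact ⟨rfl, _, a, b, rfl, ha, hb⟩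
  rst_zero X Y := ext_ev fun B _ _ x y => by
    simp
  comp_add f g h := ext_ev fun B _ _ x w => by
    simp only [ev_comp, ev_add]
    constructor
    · rintro ⟨y, hy, a, b, rfl, ha, hb⟩
      exact ⟨a, b, rfl, ⟨y, hy, ha⟩, y, hy, hb⟩
    · rintro ⟨a, b, rfl, ⟨y, hy, ha⟩, y', hy', hb⟩
      obtain rfl := hy.unique hy'
      exact ⟨y, hy, a, b, rfl, ha, hb⟩
  comp_zero Z f := ext_ev fun B _ _ x y => by
    simp

/-- Compatibility concerns only points where both sides are defined, so preservation of sums of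
values is enough there, by uniqueness of values. -/
theorem isAdditiveMap_of_ev {X Y : RatCat R} {f : X ⟶ Y}
    (hadd : ∀ (B : Type u) [CommRing B] [Algebra R B] (x x' : Pt B X) (y y' : Pt B Y),
      Ev f x y → Ev f x' y' → Ev f (x + x') (y + y'))
    (hzero : ∀ (B : Type u) [CommRing B] [Algebra R B], Ev f (0 : Pt B X) 0) :
    IsAdditiveMap f := by
  refine fun Z => ⟨fun s t => ext_ev fun B _ _ z w => ?_, ext_ev fun B _ _ z w => ?_⟩
  · simp only [ev_comp, ev_rst, ev_add]
    constructor
    · rintro ⟨_, ⟨rfl, w', _, ⟨x, x', rfl, hx, hx'⟩, hw'⟩, y, y', rfl, ⟨a, ha, hy⟩, a', ha', hy'⟩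
      exact ⟨_, ⟨rfl, _, y, y', rfl, ⟨a, ha, hy⟩, a', ha', hy'⟩, _, ⟨a, a', rfl, ha, ha'⟩,
        hadd B _ _ _ _ hy hy'⟩
    · rintro ⟨_, ⟨rfl, _, y, y', rfl, ⟨a, ha, hy⟩, a', ha', hy'⟩, _, ⟨x, x', rfl, hx, hx'⟩, hw⟩
      obtain rfl := ha.unique hx
      obtain rfl := ha'.unique hx'
      exact ⟨_, ⟨rfl, w, _, ⟨a, a', rfl, ha, ha'⟩, hw⟩, y, y',
        hw.unique (hadd B _ _ _ _ hy hy'), ⟨a, ha, hy⟩, a', ha', hy'⟩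
  · simp only [ev_comp, ev_rst, ev_zero]
    constructor
    · rintro ⟨_, ⟨rfl, _⟩, rfl⟩
      exact ⟨_, ⟨rfl, 0, rfl⟩, 0, rfl, hzero B⟩
    · rintro ⟨_, ⟨rfl, _⟩, _, rfl, hw⟩
      exact ⟨_, ⟨rfl, _, 0, rfl, hw⟩, hw.unique (hzero B)⟩

instance isCartesianLeftAdditiveRestrictionCategory :
    IsCartesianLeftAdditiveRestrictionCategory (RatCat R) where
  toIsCartesianRestrictionCategory := isCartesianRestrictionCategory
  hom_add_assoc := isLeftAdditiveRestrictionCategory.hom_add_assoc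
  hom_add_comm := isLeftAdditiveRestrictionCategory.hom_add_comm
  hom_zero_add := isLeftAdditiveRestrictionCategory.hom_zero_add
  rst_add := isLeftAdditiveRestrictionCategory.rst_add
  rst_zero := isLeftAdditiveRestrictionCategory.rst_zero
  comp_add := isLeftAdditiveRestrictionCategory.comp_add
  comp_zero := isLeftAdditiveRestrictionCategory.comp_zero
  prodMap_add f g h k := ext_ev fun B _ _ p q => by
    obtain ⟨x, y, rfl⟩ := exists_ptPair p
    simp only [ev_prodMap, ev_add]
    constructor
    · rintro ⟨_, _, rfl, ⟨a, b, rfl, ha, hb⟩, c, d, rfl, hc, hd⟩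
      exact ⟨_, _, ptPair_add a b c d, ⟨a, c, rfl, ha, hc⟩, b, d, rfl, hb, hd⟩
    · rintro ⟨_, _, rfl, ⟨a, c, rfl, ha, hc⟩, b, d, rfl, hb, hd⟩
      exact ⟨_, _, (ptPair_add a b c d).symm, ⟨a, b, rfl, ha, hb⟩, c, d, rfl, hc, hd⟩
  prodMap_zero X Y X' Y' := ext_ev fun B _ _ p q => by
    obtain ⟨x, y, rfl⟩ := exists_ptPair p
    simp [ptPair_zero]
  fst_additive X Y := isAdditiveMap_of_ev
    (fun B _ _ x x' y y' h h' => by rw [ev_fst] at *; rw [h, h', ptFst_add])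
    (fun B _ _ => ev_fst.2 rfl)
  snd_additive X Y := isAdditiveMap_of_ev
    (fun B _ _ x x' y y' h h' => by rw [ev_snd] at *; rw [h, h', ptSnd_add])
    (fun B _ _ => ev_snd.2 rfl)
  diag_additive X := isAdditiveMap_of_ev
    (fun B _ _ x x' y y' h h' => by
      rw [ev_pair] at *
      obtain ⟨_, _, rfl, h1, h2⟩ := h
      obtain ⟨_, _, rfl, h3, h4⟩ := h'
      rw [ev_id] at h1 h2 h3 h4
      subst h1 h2 h3 h4
      exact ⟨_, _, (ptPair_add _ _ _ _).symm, ev_id.2 rfl, ev_id.2 rfl⟩)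
    (fun B _ _ => ev_pair.2 ⟨0, 0, ptPair_zero.symm, ev_id.2 rfl, ev_id.2 rfl⟩)

/-! ### The differential axioms -/

instance isDifferentialRestrictionCategory : IsDifferentialRestrictionCategory (RatCat R) where
  toIsCartesianLeftAdditiveRestrictionCategory := isCartesianLeftAdditiveRestrictionCategory
  dr1_add f g := ext_ev fun B _ _ p w => by
    obtain ⟨v, x, rfl⟩ := exists_ptPair p
    simp only [ev_add, ev_D]
    constructor
    · rintro ⟨y, a, b, h, ha, hb⟩
      obtain ⟨a, a', rfl⟩ := exists_dual a
      obtain ⟨b, b', rfl⟩ := exists_dual b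
      rw [dual_add, dual_inj] at h
      exact ⟨a', b', h.2, ⟨a, ha⟩, b, hb⟩
    · rintro ⟨a', b', rfl, ⟨a, ha⟩, b, hb⟩
      exact ⟨a + b, _, _, (dual_add _ _ _ _).symm, ha, hb⟩
  dr1_zero X Y := ext_ev fun B _ _ p w => by
    obtain ⟨v, x, rfl⟩ := exists_ptPair p
    simp [ev_D, ← dual_zero]
  dr2_add f g h k := ext_ev fun B _ _ z w => by
    simp only [ev_comp, ev_pair, ev_add]
    constructor
    · rintro ⟨_, ⟨_, c, rfl, ⟨a, b, rfl, ha, hb⟩, hc⟩, hw⟩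
      -- The domain of the differential does not depend on the direction, so definedness at `a + b`
      -- gives it at `a` and at `b`.
      obtain ⟨y, hy⟩ := hw.of_D
      obtain ⟨wa, hwa⟩ := hy.exists_D a
      obtain ⟨wb, hwb⟩ := hy.exists_D b
      exact ⟨wa, wb, hw.unique (hwa.D_add hwb), ⟨_, ⟨a, c, rfl, ha, hc⟩, hwa⟩, _,
        ⟨b, c, rfl, hb, hc⟩, hwb⟩
    · rintro ⟨wa, wb, rfl, ⟨_, ⟨a, c, rfl, ha, hc⟩, hwa⟩, _, ⟨b, c', rfl, hb, hc'⟩, hwb⟩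
      obtain rfl := hc.unique hc'
      exact ⟨_, ⟨_, c, rfl, ⟨a, b, rfl, ha, hb⟩, hc⟩, hwa.D_add hwb⟩
  dr2_zero f g := ext_ev fun B _ _ z w => by
    simp only [ev_comp, ev_pair, ev_zero, ev_rst]
    constructor
    · rintro ⟨_, ⟨_, c, rfl, rfl, hc⟩, hw⟩
      obtain ⟨y, hy⟩ := hw.of_D
      exact ⟨z, ⟨rfl, y, c, hc, hy⟩, hw.unique hy.D_zero⟩
    · rintro ⟨_, ⟨rfl, y, c, hc, hy⟩, rfl⟩
      exact ⟨_, ⟨_, c, rfl, rfl, hc⟩, hy.D_zero⟩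
  dr3_fst X Y := ext_ev fun B _ _ p w => by
    obtain ⟨v, x, rfl⟩ := exists_ptPair p
    simp [ev_D]
  dr3_snd X Y := ext_ev fun B _ _ p w => by
    obtain ⟨v, x, rfl⟩ := exists_ptPair p
    simp [ev_D]
  dr4 f g := ext_ev fun B _ _ p w => by
    obtain ⟨v, x, rfl⟩ := exists_ptPair p
    simp only [ev_D, ev_pair]
    constructor
    · rintro ⟨y, a, b, h, ha, hb⟩
      obtain ⟨a, a', rfl⟩ := exists_dual a
      obtain ⟨b, b', rfl⟩ := exists_dual b
      rw [← dual_ptPair, dual_inj] at h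
      exact ⟨a', b', h.2, ⟨a, ha⟩, b, hb⟩
    · rintro ⟨a', b', rfl, ⟨a, ha⟩, b, hb⟩
      exact ⟨ptPair a b, _, _, dual_ptPair _ _ _ _, ha, hb⟩
  dr5 f g := ext_ev fun B _ _ p w => by
    obtain ⟨v, x, rfl⟩ := exists_ptPair p
    simp only [ev_D, ev_comp, ev_pair, ev_snd]
    constructor
    · rintro ⟨z, y, hy, hz⟩
      obtain ⟨y, y', rfl⟩ := exists_dual y
      -- Chain rule: `f(x + εv) = y + εy'` is itself a dual point, and evaluating `g` at it is
      -- evaluating the differential of `g` at `(y', y)`.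
      exact ⟨_, ⟨y', y, rfl, ⟨y, hy⟩, x, by simp, hy.of_dual⟩, ev_D.2 ⟨z, hz⟩⟩
    · rintro ⟨_, ⟨y', y, rfl, ⟨y'', hy⟩, x', hx', hy'⟩, hw⟩
      rw [ptSnd_ptPair] at hx'
      subst hx'
      -- The base point supplied by `π₁f` must agree with the constant part of `f(x + εv)`.
      obtain rfl := hy'.unique hy.of_dual
      obtain ⟨z, hz⟩ := ev_D.1 hw
      exact ⟨z, _, hy, hz⟩
  dr6 f g h k := ext_ev fun B _ _ z w => by
    simp only [ev_comp, ev_pair, ev_zero, ev_rst]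
    constructor
    · rintro ⟨_, ⟨_, _, rfl, ⟨a, _, rfl, ha, rfl⟩, b, c, rfl, hb, hc⟩, hw⟩
      exact ⟨z, ⟨rfl, b, hb⟩, _, ⟨a, c, rfl, ha, hc⟩, ev_D_D_fst.1 hw⟩
    · rintro ⟨_, ⟨rfl, b, hb⟩, _, ⟨a, c, rfl, ha, hc⟩, hw⟩
      exact ⟨_, ⟨_, _, rfl, ⟨a, _, rfl, ha, rfl⟩, b, c, rfl, hb, hc⟩, ev_D_D_fst.2 hw⟩
  dr7 f g h k := ext_ev fun B _ _ z w => by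
    simp only [ev_comp, ev_pair, ev_zero]
    constructor <;>
    · rintro ⟨_, ⟨_, _, rfl, ⟨_, a, rfl, rfl, ha⟩, b, c, rfl, hb, hc⟩, hw⟩
      exact ⟨_, ⟨_, _, rfl, ⟨_, b, rfl, rfl, hb⟩, a, c, rfl, ha, hc⟩, ev_D_D_swap hw⟩
  dr8 f := ext_ev fun B _ _ p w => by
    obtain ⟨v, x, rfl⟩ := exists_ptPair p
    simp only [ev_D, ev_comp, ev_prodMap, ev_rst, ev_id, ev_fst, dual_inj]
    constructor
    · rintro ⟨_, ⟨rfl, rfl⟩, y, hy⟩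
      obtain ⟨y, y', rfl⟩ := exists_dual y
      exact ⟨_, ⟨_, _, rfl, rfl, rfl, y, hy.of_dual⟩, by simp⟩
    · rintro ⟨_, ⟨_, _, rfl, rfl, rfl, y, hy⟩, rfl⟩
      obtain ⟨y', h⟩ := hy.exists_dual _
      exact ⟨_, ⟨rfl, by simp⟩, _, h⟩
  dr9 f := ext_ev fun B _ _ p w => by
    obtain ⟨v, x, rfl⟩ := exists_ptPair p
    simp only [ev_prodMap, ev_rst, ev_id]
    constructor
    · rintro ⟨rfl, y, hy⟩
      exact ⟨_, _, rfl, rfl, rfl, hy.of_D⟩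
    · rintro ⟨_, _, rfl, rfl, rfl, y, hy⟩
      exact ⟨rfl, hy.exists_D _⟩

end RatCat

end

theorem mainTheorem1 (R : Type*) [CommRing R] :
    IsDifferentialRestrictionCategory (RatCat R) :=
  RatCat.isDifferentialRestrictionCategory
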